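/- Let $\sigma$ be a real number with $\sigma<\frac12$ and put $\rho=1-2\sigma>0$. For $N\ge 1$ let $\mathbf T_N(\psi_\sigma)$ be the $N\times N$ truncated multiplicative Toeplitz matrix with symbol $\psi_\sigma(s)=\zeta(\sigma+s)$, that is, the matrix whose $(n,m)$ entry ($1\le n,m\le N$) is $(n/m)^{-\sigma}$ if $m$ divides $n$ and $0$ otherwise; let $s_1(\mathbf T_N(\psi_\sigma))\ge\dots\ge s_N(\mathbf T_N(\psi_\sigma))\ge 0$ be its singular values, repeated according to multiplicity. Let $$E(\sigma,1)=\left\{\frac{n^\sigma m^\sigma}{[n,m]}\right\}_{n,m=1}^\infty,$$ where $[n,m]$ is the least common multiple of $n$ and $m$. Then the infinite matrix $E(\sigma,1)$ defines a bounded, compact, positive operator on $\ell^2(\mathbb N)$, its eigenvalues can be listed in non-increasing order, with multiplicities taken into account, as an infinite sequence $\{\lambda_n(E(\sigma,1))\}_{n=1}^\infty$, and $$s_n^2(\mathbf T_N(\psi_\sigma))=\frac1\rho N^\rho\bigl(\lambda_n(E(\sigma,1))+o(1)\bigr),\qquad N\to\infty,$$ uniformly over $1\le n\le N$; that is, $$\sup_{1\le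 n\le N}\left|\rho N^{-\rho}s_n^2(\mathbf T_N(\psi_\sigma))-\lambda_n(E(\sigma,1))\right|\to 0\qquad(N\to\infty).$$ -/

import Mathlib

noncomputable section

/-- The complex Hilbert space `ℓ²(ℕ)`, with coordinates indexed by the positive integers. -/
abbrev EllTwo : Type := lp (fun _ : ℕ+ => ℂ) 2

/-- The `(n, m)` entry `n ^ σ * m ^ σ / [n, m] ^ τ` of the infinite arithmetical matrix `E(σ, τ)`,
where `[n, m]` is the least common multiple. -/
def arithEntry (σ τ : ℝ) (n m : ℕ+) : ℝ :=
  ((n : ℕ) : ℝ) ^ σ * ((m : ℕ) : ℝ) ^ σ / ((Nat.lcm n m : ℕ) : ℝ) ^ τ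

/-- The bounded operator `A` on `ℓ²(ℕ)` has the infinite matrix `a`: the image of the `m`-th
standard basis vector is the `m`-th column of `a`. This determines `A`. -/
def HasInfiniteMatrix (A : EllTwo →L[ℂ] EllTwo) (a : ℕ+ → ℕ+ → ℝ) : Prop :=
  ∀ n m : ℕ+, (A (lp.single 2 m (1 : ℂ)) : ℕ+ → ℂ) n = (a n m : ℂ)

/-- `lam 0 ≥ lam 1 ≥ lam 2 ≥ …` is the list of all eigenvalues of `A` in non-increasing order,
repeated according to multiplicity: every complex number `z` occurs in the list exactly
`dim ker (A - z)` times. There is at most one such list. -/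
structure IsEigenvalueList (A : EllTwo →L[ℂ] EllTwo) (lam : ℕ → ℝ) : Prop where
  antitone : Antitone lam
  multiplicity : ∀ z : ℂ, {n : ℕ | (lam n : ℂ) = z}.encard =
    Cardinal.toENat (Module.rank ℂ (Module.End.eigenspace (A : EllTwo →ₗ[ℂ] EllTwo) z))

/-- The `N × N` truncated multiplicative Toeplitz matrix `{ψ_{n/m}}_{n,m=1}^N` of the coefficients
`ψ_1, ψ_2, …`, where `ψ_q = 0` if `q` is not an integer. The row and the column with the index
`i : Fin N` are those of the integer `i + 1`. -/
def truncMultToeplitz (ψ : ℕ → ℂ) (N : ℕ) : Matrix (Fin N) (Fin N) ℂ :=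
  fun i j =>
    if ((j : ℕ) + 1) ∣ ((i : ℕ) + 1) then ψ (((i : ℕ) + 1) / ((j : ℕ) + 1)) else 0

/-- The coefficients `n ^ (-σ)` of the Dirichlet series of `ψ_σ(s) = ζ(σ + s)`. -/
def zetaShiftCoeff (σ : ℝ) (n : ℕ) : ℂ := (((n : ℝ) ^ (-σ) : ℝ) : ℂ)

/-- The singular values `s 0 ≥ s 1 ≥ … ≥ s (N - 1)` of an `N × N` matrix, repeated according to
multiplicity: the square roots of the eigenvalues of `Mᴴ * M`. -/
def matrixSingularValue {N : ℕ} (M : Matrix (Fin N) (Fin N) ℂ) (n : ℕ) : ℝ :=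
  LinearMap.singularValues (Matrix.toEuclideanLin M) n

end

/-!
Let `ρ = 1 - 2 * σ` and let `T` be the `N × N` truncated Toeplitz matrix. The `(n, m)` entry of
`ρ * N ^ (-ρ) * Tᴴ * T` is a sum over the multiples of `l = [n, m]` up to `N`,

`ρ * N ^ (-ρ) * (n * m) ^ σ * l ^ (-2 * σ) * ∑ k ≤ N / l, k ^ (-2 * σ)`,

and as `∑ k ≤ K, k ^ (ρ - 1) ~ K ^ ρ / ρ`, it tends to the entry `(n * m) ^ σ / l` of `E(σ, 1)` and
is bounded by a constant times that entry (`tendsto_truncGramEntry`, `exists_truncGramEntry_le`).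

The convergence holds in the operator norm, by Schur's test with the weight `m ^ (-1/2)`
(`HasInfiniteMatrix.opNorm_le_of_sum_le`). The `n`-th Schur sum of `E(σ, 1)`, relative to the
weight, is at most a constant times `n ^ (-ρ/2) * ∑ d ∣ n, d ^ (-ρ/2)`, which tends to zero by the
divisor bound; this dominates the Schur sums of the difference for large `n`, and for each of the
other `n` dominated convergence applies (`eventually_sum_truncGramEntry_sub_le`). So `E(σ, 1)` is obtained as
the norm limit of positive operators of finite rank (`exists_tendsto_truncGram`), whence it is
compact and positive.

It is also injective: the sums over the multiples of each `d` of the weighted coordinates of a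
kernel vector vanish, and a sieve recovers the coordinates
(`HasInfiniteMatrix.eq_zero_of_apply_eq_zero`,
`eq_zero_of_forall_tsum_multiples_eq_zero`). Therefore all eigenvalues are positive, have finite
multiplicity and accumulate only at zero, and there is an infinite non-increasing list of them
(`exists_antitone_eigenbasis`). Finally, by the Courant–Fischer argument, eigenvalues with the same
index differ by at most the norm of the difference of the operators, uniformly in the index
(`abs_singularValue_sq_sub_le`).
-/

open Filter Topology Asymptotics Module Module.End
open scoped InnerProductSpace

/-! ### Eigenvalues of compact positive operators -/

/-- A compact operator sends an orthonormal family of eigenvectors to a family with only finitely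
many members of norm at least `ε`: infinitely many would be separated by `√2 * ε`. -/
theorem Orthonormal.finite_setOf_le_of_isCompactOperator {H : Type*} [NormedAddCommGroup H]
    [InnerProductSpace ℂ H] {A : H →L[ℂ] H} (hA : IsCompactOperator A) {ι : Type*} {v : ι → H}
    (hv : Orthonormal ℂ v) {f : ι → ℝ} (hf : ∀ i, A (v i) = (f i : ℂ) • v i) {ε : ℝ} (hε : 0 < ε) :
    {i | ε ≤ f i}.Finite := by
  by_contra hinf
  have hinf' : {i | ε ≤ f i}.Infinite := hinf
  let e : ℕ ↪ {i | ε ≤ f i} := hinf'.natEmbedding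
  obtain ⟨K, hK, hAK⟩ :=
    IsCompactOperator.image_closedBall_subset_compact (f := (A : H →ₗ[ℂ] H)) hA 1
  have hmem : ∀ k : ℕ, A (v (e k)) ∈ K := fun k =>
    hAK ⟨v (e k), by simp [hv.1], rfl⟩
  obtain ⟨a, -, φ, hφ, hlim⟩ := hK.tendsto_subseq hmem
  have hC := hlim.cauchySeq
  rw [Metric.cauchySeq_iff] at hC
  obtain ⟨n₀, hn₀⟩ := hC ε hε
  have h1 := hn₀ n₀ le_rfl (n₀ + 1) (Nat.le_succ _)
  have hne : ((e (φ n₀) : {i | ε ≤ f i}) : ι) ≠ e (φ (n₀ + 1)) := by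
    intro h
    have := e.injective (Subtype.ext h)
    exact absurd (hφ.injective this) (by omega)
  simp only [Function.comp_apply, dist_eq_norm, hf] at h1
  set i : ι := ((e (φ n₀) : {i | ε ≤ f i}) : ι) with hi
  set j : ι := ((e (φ (n₀ + 1)) : {i | ε ≤ f i}) : ι) with hj
  have hfi : ε ≤ f i := (e (φ n₀)).2
  have horth : ⟪(f i : ℂ) • v i, (f j : ℂ) • v j⟫_ℂ = 0 := by
    rw [inner_smul_left, inner_smul_right, hv.2 hne]; simp
  have hpyth := norm_sub_sq (𝕜 := ℂ) ((f i : ℂ) • v i) ((f j : ℂ) • v j)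
  rw [horth, norm_smul, norm_smul, hv.1, hv.1] at hpyth
  simp only [Complex.norm_real, mul_one, Real.norm_eq_abs, sq_abs, map_zero, mul_zero,
    sub_zero] at hpyth
  nlinarith [norm_nonneg ((f i : ℂ) • v i - (f j : ℂ) • v j), sq_nonneg (f j)]

/-- The eigenspaces of a compact operator for nonzero eigenvalues are finite-dimensional. -/
theorem IsCompactOperator.finiteDimensional_eigenspace {H : Type*} [NormedAddCommGroup H]
    [InnerProductSpace ℂ H] [CompleteSpace H] {A : H →L[ℂ] H} (hA : IsCompactOperator A) {z : ℂ}
    (hz : z ≠ 0) : FiniteDimensional ℂ (eigenspace (A : H →ₗ[ℂ] H) z) := by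
  have hcl : IsClosed (eigenspace (A : H →ₗ[ℂ] H) z : Set H) := by
    have : (eigenspace (A : H →ₗ[ℂ] H) z : Set H) = {x | A x = z • x} := by
      ext x; simp
    rw [this]
    exact isClosed_eq A.continuous (continuous_const_smul z)
  have hinv : ∀ v ∈ eigenspace (A : H →ₗ[ℂ] H) z, (A : H →ₗ[ℂ] H) v ∈
      eigenspace (A : H →ₗ[ℂ] H) z := by
    intro v hv
    rw [mem_eigenspace_iff.1 hv]
    exact Submodule.smul_mem _ _ hv
  have h1 := IsCompactOperator.restrict (f := (A : H →ₗ[ℂ] H)) hA hinv hcl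
  have h2 := h1.smul (z⁻¹)
  have h3 : z⁻¹ • ⇑((A : H →ₗ[ℂ] H).restrict hinv) = id := by
    funext x
    apply Subtype.ext
    have : A (x : H) = z • (x : H) := mem_eigenspace_iff.1 x.2
    simp [this, smul_smul, hz]
  rw [h3] at h2
  exact FiniteDimensional.of_isCompactOperator_id (𝕜 := ℂ) h2

/-- An infinite family of positive numbers with finitely many members above each positive level can
be listed in non-increasing order. -/
theorem exists_equiv_nat_antitone {ι : Type*} [Infinite ι] {f : ι → ℝ} (hpos : ∀ i, 0 < f i)
    (hfin : ∀ ε, 0 < ε → {i | ε ≤ f i}.Finite) : ∃ e : ℕ ≃ ι, Antitone (f ∘ e) := by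
  -- Ties are broken by an arbitrary well-order; every initial segment is then finite.
  let _ : LinearOrder ι := IsWellOrder.linearOrder (WellOrderingRel (α := ι))
  let g : ι → ℝᵒᵈ ×ₗ ι := fun i => toLex (OrderDual.toDual (f i), i)
  have hg : Function.Injective g := fun i j h => by
    have := congrArg (fun p => (ofLex p).2) h
    simpa [g] using this
  have key : ∃ o : LinearOrder ι, ∀ i j, o.le i j → f j ≤ f i := by
    refine ⟨LinearOrder.lift' g hg, fun i j h => ?_⟩
    have h' : g i ≤ g j := h
    rw [Prod.Lex.le_iff] at h'
    rcases h' with h' | h'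
    · exact le_of_lt h'
    · exact (OrderDual.toDual.injective h'.1).ge
  clear_value g
  obtain ⟨o, ho⟩ := key
  let _ := o
  have hIic : ∀ i : ι, (Set.Iic i).Finite := fun i =>
    (hfin (f i) (hpos i)).subset fun j hj => ho j i hj
  let _ : LocallyFiniteOrder ι := LocallyFiniteOrder.ofFiniteIcc fun a b =>
    (hIic b).subset fun x hx => hx.2
  let _ : SuccOrder ι := LinearLocallyFiniteOrder.succOrder ι
  let _ : PredOrder ι := LinearLocallyFiniteOrder.predOrder ι
  obtain ⟨i₀⟩ : Nonempty ι := inferInstance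
  obtain ⟨m, hm, hmin⟩ := (hIic i₀).exists_minimal ⟨i₀, le_refl i₀⟩
  let _ : OrderBot ι :=
    { bot := m
      bot_le := fun a => by
        by_contra h
        have h1 : a ≤ m := le_of_not_ge h
        exact h (hmin (le_trans h1 hm) h1) }
  have : NoMaxOrder ι := ⟨fun a => by
    by_contra h
    push Not at h
    exact Set.infinite_univ ((hIic a).subset fun x _ => h x)⟩
  refine ⟨(orderIsoNatOfLinearSuccPredArch (ι := ι)).symm.toEquiv, fun a b hab => ?_⟩
  exact ho _ _ ((orderIsoNatOfLinearSuccPredArch (ι := ι)).symm.monotone hab)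

/-- The spectral theorem for a compact, positive, injective operator on an infinite-dimensional
Hilbert space: there is a Hilbert basis of eigenvectors, listed by non-increasing eigenvalue, and
the list of eigenvalues counts each complex number as often as the dimension of its eigenspace. -/
theorem exists_antitone_eigenbasis {H : Type*} [NormedAddCommGroup H] [InnerProductSpace ℂ H]
    [CompleteSpace H] (hinf : ¬ FiniteDimensional ℂ H) {A : H →L[ℂ] H} (hA : IsCompactOperator A)
    (hpos : A.IsPositive) (hinj : ∀ x, A x = 0 → x = 0) :
    ∃ (lam : ℕ → ℝ) (b : HilbertBasis ℕ ℂ H), Antitone lam ∧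
      (∀ n, A (b n) = (lam n : ℂ) • b n) ∧
      ∀ z : ℂ, {n : ℕ | (lam n : ℂ) = z}.encard =
        Cardinal.toENat (Module.rank ℂ (eigenspace (A : H →ₗ[ℂ] H) z)) := by
  have hsymm : A.IsSymmetric := hpos.isSelfAdjoint.isSymmetric
  -- The kernel is trivial, so that every eigenspace is finite-dimensional and its `finrank` is the
  -- multiplicity.
  have hfd : ∀ z : ℂ, FiniteDimensional ℂ (eigenspace (A : H →ₗ[ℂ] H) z) := by
    intro z
    rcases eq_or_ne z 0 with rfl | hz
    · have : eigenspace (A : H →ₗ[ℂ] H) 0 = ⊥ := by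
        rw [Submodule.eq_bot_iff]
        intro x hx
        exact hinj x (by simpa using mem_eigenspace_iff.1 hx)
      rw [this]; infer_instance
    · exact hA.finiteDimensional_eigenspace hz
  let ι := Σ z : ℂ, Fin (finrank ℂ (eigenspace (A : H →ₗ[ℂ] H) z))
  let w : ∀ z : ℂ, OrthonormalBasis (Fin (finrank ℂ (eigenspace (A : H →ₗ[ℂ] H) z))) ℂ
    (eigenspace (A : H →ₗ[ℂ] H) z) := fun z => stdOrthonormalBasis ℂ _
  let v : ι → H := fun i => (w i.1 i.2 : H)
  have hv : Orthonormal ℂ v :=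
    hsymm.orthogonalFamily_eigenspaces.orthonormal_sigma_orthonormal (fun z => (w z).orthonormal)
  have hAv : ∀ i : ι, A (v i) = i.1 • v i := fun i => mem_eigenspace_iff.1 (w i.1 i.2).2
  have hv0 : ∀ i, v i ≠ 0 := hv.ne_zero
  have hre : ∀ i : ι, ((i.1.re : ℝ) : ℂ) = i.1 := by
    intro i
    have := hsymm.conj_eigenvalue_eq_self
      (hasEigenvalue_of_hasEigenvector ⟨mem_eigenspace_iff.2 (hAv i), hv0 i⟩)
    exact Complex.conj_eq_iff_re.1 this
  let f : ι → ℝ := fun i => i.1.re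
  have hAf : ∀ i : ι, A (v i) = (f i : ℂ) • v i := fun i => by rw [hAv, hre]
  have hfpos : ∀ i, 0 < f i := by
    intro i
    have h1 : 0 ≤ f i := by
      have h2 := hpos.re_inner_nonneg_right (v i)
      rw [hAf, inner_smul_right, inner_self_eq_norm_sq_to_K, hv.1] at h2
      simpa using h2
    refine lt_of_le_of_ne h1 fun h => hv0 i (hinj _ ?_)
    rw [hAf, ← h]; simp
  have hspan : (Submodule.span ℂ (Set.range v))ᗮ = ⊥ := by
    rw [eq_bot_iff, ← ContinuousLinearMap.orthogonalComplement_iSup_eigenspaces_eq_bot hA hsymm]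
    apply Submodule.orthogonal_le
    refine iSup_le fun z x hx => ?_
    have h1 := (w z).sum_repr ⟨x, hx⟩
    have h2 : x = ∑ k, (w z).repr ⟨x, hx⟩ k • v ⟨z, k⟩ := by
      have := congrArg (Subtype.val) h1
      simpa [v] using this.symm
    rw [h2]
    exact Submodule.sum_mem _ fun k _ =>
      Submodule.smul_mem _ _ (Submodule.subset_span ⟨_, rfl⟩)
  have hinfι : Infinite ι := by
    by_contra h
    have : Finite ι := not_infinite_iff_finite.1 h
    have : FiniteDimensional ℂ (Submodule.span ℂ (Set.range v)) :=
      FiniteDimensional.span_of_finite ℂ (Set.finite_range v)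
    rw [Submodule.orthogonal_eq_bot_iff] at hspan
    apply hinf
    rw [hspan] at this
    exact LinearEquiv.finiteDimensional (Submodule.topEquiv (R := ℂ) (M := H))
  obtain ⟨e, he⟩ := exists_equiv_nat_antitone hfpos
    (fun ε hε => hv.finite_setOf_le_of_isCompactOperator hA hAf hε)
  have hve : Orthonormal ℂ (v ∘ e) := hv.comp e e.injective
  have hspan' : (Submodule.span ℂ (Set.range (v ∘ e)))ᗮ = ⊥ := by
    rw [e.surjective.range_comp]; exact hspan
  refine ⟨f ∘ e, HilbertBasis.mkOfOrthogonalEqBot hve hspan', he, fun n => ?_, fun z => ?_⟩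
  · simp only [HilbertBasis.coe_mkOfOrthogonalEqBot, Function.comp_apply]
    exact hAf _
  · have h1 : {n : ℕ | ((f ∘ e) n : ℂ) = z} =
        (fun k : Fin (finrank ℂ (eigenspace (A : H →ₗ[ℂ] H) z)) => e.symm ⟨z, k⟩) '' Set.univ := by
      ext n
      simp only [Set.mem_ofPred_eq, Function.comp_apply, Set.image_univ, Set.mem_range]
      constructor
      · intro h
        have h2 : (e n).1 = z := by rw [← h]; exact (hre _).symm
        subst h2
        exact ⟨(e n).2, by simp⟩
      · rintro ⟨k, rfl⟩
        rw [Equiv.apply_symm_apply]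
        exact hre ⟨z, k⟩
    rw [h1, Function.Injective.encard_image, ← finrank_eq_rank]
    · simp [Set.encard_univ]
    · intro a b hab
      have := e.symm.injective hab
      exact eq_of_heq (Sigma.mk.inj this).2

/-! ### Comparison of eigenvalues and Schur's test -/

/-- `n` linear conditions leave a nonzero vector in the span of `n + 1` orthonormal vectors. -/
theorem Orthonormal.exists_sum_ne_zero_forall_eq_zero {H : Type*} [NormedAddCommGroup H]
    [InnerProductSpace ℂ H] {n : ℕ} {v : Fin (n + 1) → H} (hv : Orthonormal ℂ v)
    (φ : Fin n → H →ₗ[ℂ] ℂ) :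
    ∃ c : Fin (n + 1) → ℂ, ∑ j, c j • v j ≠ 0 ∧ ∀ i, φ i (∑ j, c j • v j) = 0 := by
  let L : (Fin (n + 1) → ℂ) →ₗ[ℂ] (Fin n → ℂ) :=
    (LinearMap.pi φ).comp (Fintype.linearCombination ℂ v)
  have hker : LinearMap.ker L ≠ ⊥ := LinearMap.ker_ne_bot_of_finrank_lt (by simp)
  obtain ⟨c, hc, hc0⟩ := Submodule.exists_mem_ne_zero_of_ne_bot hker
  refine ⟨c, fun h => hc0 ?_, fun i => ?_⟩
  · funext j
    exact Fintype.linearIndependent_iff.1 hv.linearIndependent c h j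
  · have := congrFun (LinearMap.mem_ker.1 hc) i
    simpa [L, Fintype.linearCombination_apply] using this

/-- On the span of orthonormal eigenvectors with eigenvalues at least `α`, the quadratic form is at
least `α`. -/
theorem Orthonormal.mul_norm_sq_le_re_inner {H : Type*} [NormedAddCommGroup H]
    [InnerProductSpace ℂ H] {ι : Type*} [Fintype ι] {v : ι → H} (hv : Orthonormal ℂ v)
    {A : H →ₗ[ℂ] H} {f : ι → ℝ} (hf : ∀ i, A (v i) = (f i : ℂ) • v i) {α : ℝ}
    (hα : ∀ i, α ≤ f i) (c : ι → ℂ) :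
    α * ‖∑ j, c j • v j‖ ^ 2 ≤ (⟪∑ j, c j • v j, A (∑ j, c j • v j)⟫_ℂ).re := by
  have h1 : ‖∑ j, c j • v j‖ ^ 2 = ∑ j, ‖c j‖ ^ 2 := by
    have := hv.inner_sum c c Finset.univ
    rw [inner_self_eq_norm_sq_to_K] at this
    have h := congrArg Complex.re this
    simp only [Complex.re_sum, RCLike.conj_mul] at h
    norm_cast at h
  have h2 : A (∑ j, c j • v j) = ∑ j, (f j * c j : ℂ) • v j := by
    simp only [map_sum, map_smul, hf, smul_smul, mul_comm]
  rw [h1, h2, hv.inner_sum, Finset.mul_sum, Complex.re_sum]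
  refine Finset.sum_le_sum fun j _ => ?_
  have : (starRingEnd ℂ (c j)) * (f j * c j) = ((f j * ‖c j‖ ^ 2 : ℝ) : ℂ) := by
    rw [mul_left_comm, RCLike.conj_mul]; push_cast; rfl
  rw [this, Complex.ofReal_re]
  exact mul_le_mul_of_nonneg_right (hα j) (by positivity)

/-- On the vectors orthogonal to the eigenvectors with eigenvalue above `β`, the quadratic form is
at most `β`. -/
theorem HilbertBasis.re_inner_le_mul_norm_sq {H : Type*} [NormedAddCommGroup H]
    [InnerProductSpace ℂ H] {ι : Type*} (b : HilbertBasis ι ℂ H)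
    {A : H →ₗ[ℂ] H} (hA : A.IsSymmetric) {f : ι → ℝ} (hf : ∀ i, A (b i) = (f i : ℂ) • b i) {β : ℝ}
    {x : H} (hx : ∀ i, f i ≤ β ∨ ⟪b i, x⟫_ℂ = 0) :
    (⟪x, A x⟫_ℂ).re ≤ β * ‖x‖ ^ 2 := by
  have h1 := Complex.hasSum_re (b.hasSum_inner_mul_inner x x)
  have h2 := Complex.hasSum_re (b.hasSum_inner_mul_inner x (A x))
  have h3 : (⟪x, x⟫_ℂ).re = ‖x‖ ^ 2 := by
    rw [inner_self_eq_norm_sq_to_K]; norm_cast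
  rw [h3] at h1
  have e1 : ∀ i, ⟪x, b i⟫_ℂ * ⟪b i, x⟫_ℂ = ((‖⟪b i, x⟫_ℂ‖ ^ 2 : ℝ) : ℂ) := by
    intro i
    rw [← inner_conj_symm x (b i), RCLike.conj_mul]; push_cast; rfl
  have e2 : ∀ i, ⟪x, b i⟫_ℂ * ⟪b i, A x⟫_ℂ = ((f i * ‖⟪b i, x⟫_ℂ‖ ^ 2 : ℝ) : ℂ) := by
    intro i
    rw [← hA (b i) x, hf, inner_smul_left, Complex.conj_ofReal, mul_left_comm, e1]
    push_cast; rfl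
  refine hasSum_le (fun i => ?_) h2 (h1.mul_left β)
  rw [e1, e2, Complex.ofReal_re, Complex.ofReal_re]
  rcases hx i with h | h
  · exact mul_le_mul_of_nonneg_right h (by positivity)
  · simp [h]

/-- Weyl's inequality in the form of Courant and Fischer, for operators on two different Hilbert
spaces: if a contraction `J` carries the quadratic form of `A` to that of `B` with an error of at
most `δ`, if `A` has `n + 1` orthonormal eigenvectors with eigenvalues at least `α`, and if all but
`n` eigenvalues of `B` are at most `β`, then `α ≤ β + δ`. -/
theorem eigenvalue_le_eigenvalue_add {H₁ H₂ : Type*} [NormedAddCommGroup H₁]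
    [InnerProductSpace ℂ H₁] [NormedAddCommGroup H₂] [InnerProductSpace ℂ H₂]
    {n : ℕ} {A : H₁ →ₗ[ℂ] H₁} {v : Fin (n + 1) → H₁} (hv : Orthonormal ℂ v)
    {f : Fin (n + 1) → ℝ} (hf : ∀ i, A (v i) = (f i : ℂ) • v i) {α : ℝ} (hα : ∀ i, α ≤ f i)
    {B : H₂ →ₗ[ℂ] H₂} (hB : B.IsSymmetric) {ι : Type*} (b : HilbertBasis ι ℂ H₂)
    {g : ι → ℝ} (hg : ∀ i, B (b i) = (g i : ℂ) • b i) {β : ℝ} (hβ : 0 ≤ β) (s : Fin n → ι)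
    (hs : ∀ i, g i ≤ β ∨ i ∈ Set.range s) {J : H₁ →ₗ[ℂ] H₂} (hJ : ∀ x, ‖J x‖ ≤ ‖x‖) {δ : ℝ}
    (hAB : ∀ x, (⟪x, A x⟫_ℂ).re ≤ (⟪J x, B (J x)⟫_ℂ).re + δ * ‖x‖ ^ 2) :
    α ≤ β + δ := by
  -- Choose `x` in the span of the eigenvectors of `A` with `J x` orthogonal to the exceptional
  -- eigenvectors of `B`.
  obtain ⟨c, hc0, hc⟩ := hv.exists_sum_ne_zero_forall_eq_zero
    (fun i => (innerSL ℂ (b (s i)) : H₂ →ₗ[ℂ] ℂ).comp J)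
  set x := ∑ j, c j • v j with hx
  have h1 : α * ‖x‖ ^ 2 ≤ (⟪x, A x⟫_ℂ).re := hv.mul_norm_sq_le_re_inner hf hα c
  have h2 : (⟪J x, B (J x)⟫_ℂ).re ≤ β * ‖J x‖ ^ 2 := by
    refine b.re_inner_le_mul_norm_sq hB hg fun i => ?_
    rcases hs i with h | ⟨k, rfl⟩
    · exact Or.inl h
    · exact Or.inr (by simpa using hc k)
  have h3 : β * ‖J x‖ ^ 2 ≤ β * ‖x‖ ^ 2 := by gcongr; exact hJ x
  have h4 : α * ‖x‖ ^ 2 ≤ (β + δ) * ‖x‖ ^ 2 := by linarith [hAB x]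
  exact le_of_mul_le_mul_right h4 (by positivity)

/-- Schur's test: a bounded operator with a symmetric real matrix `b` such that `|b|` applied to a
positive weight `w` is at most `δ * w` has norm at most `δ`. -/
theorem HasInfiniteMatrix.opNorm_le_of_sum_le {B : EllTwo →L[ℂ] EllTwo} {b : ℕ+ → ℕ+ → ℝ}
    (hB : HasInfiniteMatrix B b) (hb : ∀ n m, b n m = b m n) {w : ℕ+ → ℝ} (hw : ∀ n, 0 < w n)
    {δ : ℝ} (hδ : 0 ≤ δ) (h : ∀ (s : Finset ℕ+) (n : ℕ+), ∑ m ∈ s, |b n m| * w m ≤ δ * w n) :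
    ‖B‖ ≤ δ := by
  have key : ∀ (x y : EllTwo), ‖⟪y, B x⟫_ℂ‖ ≤ δ / 2 * (‖x‖ ^ 2 + ‖y‖ ^ 2) := by
    intro x y
    have hlim : ∀ z : EllTwo, Tendsto (fun s : Finset ℕ+ => ∑ i ∈ s, lp.single 2 i (z i))
        atTop (𝓝 z) := fun z => lp.hasSum_single (by simp) z
    have hlim2 := ((hlim y).inner (𝕜 := ℂ) ((B.continuous.tendsto x).comp (hlim x))).norm
    refine le_of_tendsto hlim2 (Eventually.of_forall fun s => ?_)
    have hs : ∀ z : EllTwo, ∑ i ∈ s, ‖z i‖ ^ 2 ≤ ‖z‖ ^ 2 := by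
      intro z
      have := lp.sum_rpow_le_norm_rpow (p := 2) (by simp) z s
      simpa using this
    have e1 : ∀ i, lp.single (E := fun _ : ℕ+ => ℂ) 2 i (x i) = x i • lp.single 2 i (1 : ℂ) := by
      intro i
      rw [← lp.single_smul]; simp
    have e2 : ⟪∑ i ∈ s, lp.single 2 i (y i), B (∑ i ∈ s, lp.single 2 i (x i))⟫_ℂ =
        ∑ n ∈ s, ∑ m ∈ s, starRingEnd ℂ (y n) * (x m * (b n m : ℂ)) := by
      rw [map_sum, sum_inner]
      refine Finset.sum_congr rfl fun n _ => ?_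
      rw [inner_sum]
      refine Finset.sum_congr rfl fun m _ => ?_
      rw [e1, map_smul, inner_smul_right, lp.inner_single_left, hB n m]
      simp; ring
    -- The weights enter through the inequality of the arithmetic and geometric means.
    have e3 : ∀ n m, ‖starRingEnd ℂ (y n) * (x m * (b n m : ℂ))‖ ≤
        (|b n m| * w m) * (‖y n‖ ^ 2 / w n / 2) + (|b m n| * w n) * (‖x m‖ ^ 2 / w m / 2) := by
      intro n m
      rw [norm_mul, norm_mul, RCLike.norm_conj, Complex.norm_real, Real.norm_eq_abs, hb m n]
      have hn := hw n
      have hm := hw m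
      have h0 : ‖y n‖ * ‖x m‖ ≤ w m / w n * ‖y n‖ ^ 2 / 2 + w n / w m * ‖x m‖ ^ 2 / 2 := by
        have : w m / w n * ‖y n‖ ^ 2 / 2 + w n / w m * ‖x m‖ ^ 2 / 2 - ‖y n‖ * ‖x m‖ =
            (w m * ‖y n‖ - w n * ‖x m‖) ^ 2 / (2 * (w m * w n)) := by
          field_simp
          ring
        have h' : 0 ≤ (w m * ‖y n‖ - w n * ‖x m‖) ^ 2 / (2 * (w m * w n)) := by positivity
        linarith
      have := mul_le_mul_of_nonneg_left h0 (abs_nonneg (b n m))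
      calc _ = |b n m| * (‖y n‖ * ‖x m‖) := by ring
        _ ≤ _ := this
        _ = _ := by ring
    have e4 : ∀ z : EllTwo, ∑ n ∈ s, ∑ m ∈ s, (|b n m| * w m) * (‖z n‖ ^ 2 / w n / 2) ≤
        δ / 2 * ‖z‖ ^ 2 := by
      intro z
      calc _ ≤ ∑ n ∈ s, δ / 2 * ‖z n‖ ^ 2 := by
            refine Finset.sum_le_sum fun n _ => ?_
            rw [← Finset.sum_mul]
            have hn := hw n
            calc _ ≤ (δ * w n) * (‖z n‖ ^ 2 / w n / 2) := by gcongr; exact h s n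
              _ = _ := by field_simp
        _ = δ / 2 * ∑ n ∈ s, ‖z n‖ ^ 2 := by rw [Finset.mul_sum]
        _ ≤ _ := by gcongr; exact hs z
    change ‖⟪∑ i ∈ s, lp.single 2 i (y i), B (∑ i ∈ s, lp.single 2 i (x i))⟫_ℂ‖ ≤ _
    rw [e2]
    calc _ ≤ ∑ n ∈ s, ∑ m ∈ s, ‖starRingEnd ℂ (y n) * (x m * (b n m : ℂ))‖ :=
          (norm_sum_le _ _).trans (Finset.sum_le_sum fun n _ => norm_sum_le _ _)
      _ ≤ ∑ n ∈ s, ∑ m ∈ s, ((|b n m| * w m) * (‖y n‖ ^ 2 / w n / 2) +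
            (|b m n| * w n) * (‖x m‖ ^ 2 / w m / 2)) :=
          Finset.sum_le_sum fun n _ => Finset.sum_le_sum fun m _ => e3 n m
      _ = ∑ n ∈ s, ∑ m ∈ s, (|b n m| * w m) * (‖y n‖ ^ 2 / w n / 2) +
            ∑ m ∈ s, ∑ n ∈ s, (|b m n| * w n) * (‖x m‖ ^ 2 / w m / 2) := by
          rw [Finset.sum_comm (f := fun m n => (|b m n| * w n) * (‖x m‖ ^ 2 / w m / 2))]
          simp only [Finset.sum_add_distrib]
      _ ≤ δ / 2 * (‖x‖ ^ 2 + ‖y‖ ^ 2) := by linarith [e4 x, e4 y]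
  refine B.opNorm_le_bound hδ fun x => ?_
  rcases eq_or_ne x 0 with rfl | hx
  · simp
  rcases eq_or_ne (B x) 0 with h0 | h0
  · rw [h0, norm_zero]; positivity
  have hX : 0 < ‖x‖ := norm_pos_iff.2 hx
  have hY : 0 < ‖B x‖ := norm_pos_iff.2 h0
  have h1 := key x (((‖x‖ / ‖B x‖ : ℝ) : ℂ) • B x)
  rw [inner_smul_left, inner_self_eq_norm_sq_to_K, norm_smul, norm_mul, RCLike.norm_conj,
    Complex.norm_real, norm_pow] at h1
  simp only [Real.norm_eq_abs, abs_div, abs_norm, RCLike.norm_ofReal] at h1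
  rw [div_mul_cancel₀ _ hY.ne'] at h1
  have h2 : ‖x‖ / ‖B x‖ * ‖B x‖ ^ 2 = ‖x‖ * ‖B x‖ := by field_simp
  rw [h2] at h1
  have h3 : ‖x‖ * ‖B x‖ ≤ ‖x‖ * (δ * ‖x‖) := by linarith
  exact le_of_mul_le_mul_left h3 hX

/-! ### Arithmetic lemmas -/

/-- `∑ k ≤ K, k ^ (ρ - 1) ~ K ^ ρ / ρ`, by comparison with the telescoping sum of
`k ^ ρ - (k - 1) ^ ρ`. -/
theorem tendsto_mul_sum_rpow_div_rpow {ρ : ℝ} (hρ : 0 < ρ) :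
    Tendsto (fun K : ℕ => ρ * (∑ k ∈ Finset.range K, ((k : ℝ) + 1) ^ (ρ - 1)) / (K : ℝ) ^ ρ)
      atTop (𝓝 1) := by
  -- `φ` is the quotient of the telescoping term `(k + 1) ^ ρ - k ^ ρ` by `(k + 1) ^ (ρ - 1)`; its
  -- limit is a derivative at `1`.
  let φ : ℕ → ℝ := fun k => (1 - (1 - 1 / ((k : ℝ) + 1)) ^ ρ) * ((k : ℝ) + 1)
  have hφ : Tendsto φ atTop (𝓝 ρ) := by
    have hd : HasDerivAt (fun t : ℝ => (1 - t) ^ ρ) (-ρ) 0 := by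
      have h1 : HasDerivAt (fun t : ℝ => 1 - t) (-1) 0 := by
        simpa using (hasDerivAt_id (0 : ℝ)).const_sub 1
      have h2 := h1.rpow_const (p := ρ) (Or.inl (by norm_num))
      simpa using h2
    have ht : Tendsto (fun k : ℕ => 1 / ((k : ℝ) + 1)) atTop (𝓝[≠] 0) := by
      refine tendsto_nhdsWithin_iff.2 ⟨tendsto_one_div_add_atTop_nhds_zero_nat, ?_⟩
      exact Eventually.of_forall fun k => by
        have : (0 : ℝ) < 1 / ((k : ℝ) + 1) := by positivity
        exact this.ne'
    have h3 := ((hasDerivAt_iff_tendsto_slope_zero.1 hd).comp ht).neg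
    rw [neg_neg] at h3
    refine h3.congr fun k => ?_
    have : (k : ℝ) + 1 ≠ 0 := by positivity
    simp only [Function.comp_apply, φ, zero_add, sub_zero, Real.one_rpow, smul_eq_mul, one_div,
      inv_inv]
    ring
  have hg : ∀ k : ℕ, ((k : ℝ) + 1) ^ ρ - (k : ℝ) ^ ρ = ((k : ℝ) + 1) ^ (ρ - 1) * φ k := by
    intro k
    have hk : (0 : ℝ) < (k : ℝ) + 1 := by positivity
    have h1 : 1 - 1 / ((k : ℝ) + 1) = k / ((k : ℝ) + 1) := by field_simp; ring
    simp only [φ]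
    rw [h1, Real.div_rpow (by positivity) hk.le, Real.rpow_sub_one hk.ne']
    have := (Real.rpow_pos_of_pos hk ρ).ne'
    field_simp
  have hgpos : ∀ k : ℕ, 0 < ((k : ℝ) + 1) ^ ρ - (k : ℝ) ^ ρ := fun k =>
    sub_pos.2 (Real.rpow_lt_rpow (by positivity) (by linarith) hρ)
  have hsum : ∀ K : ℕ, ∑ k ∈ Finset.range K, (((k : ℝ) + 1) ^ ρ - (k : ℝ) ^ ρ) = (K : ℝ) ^ ρ := by
    intro K
    have := Finset.sum_range_sub (fun k : ℕ => (k : ℝ) ^ ρ) K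
    simpa [Real.zero_rpow hρ.ne'] using this
  have hlo : (fun k : ℕ => ρ * ((k : ℝ) + 1) ^ (ρ - 1) - (((k : ℝ) + 1) ^ ρ - (k : ℝ) ^ ρ))
      =o[atTop] fun k : ℕ => ((k : ℝ) + 1) ^ ρ - (k : ℝ) ^ ρ := by
    rw [isLittleO_iff_tendsto (fun k hk => absurd hk (hgpos k).ne')]
    have h1 : Tendsto (fun k => (ρ - φ k) / φ k) atTop (𝓝 ((ρ - ρ) / ρ)) :=
      (tendsto_const_nhds.sub hφ).div hφ hρ.ne'
    rw [sub_self, zero_div] at h1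
    refine h1.congr fun k => ?_
    have hk : (0 : ℝ) < ((k : ℝ) + 1) ^ (ρ - 1) := by positivity
    rw [hg k, mul_comm ρ, ← mul_sub, mul_div_mul_left _ _ hk.ne']
  have htop : Tendsto (fun K : ℕ => (K : ℝ) ^ ρ) atTop atTop :=
    (tendsto_rpow_atTop hρ).comp tendsto_natCast_atTop_atTop
  have h2 := hlo.sum_range (fun k => (hgpos k).le) (by simpa only [hsum] using htop)
  simp only [hsum, Finset.sum_sub_distrib (f := fun k : ℕ => ρ * ((k : ℝ) + 1) ^ (ρ - 1)),
    ← Finset.mul_sum] at h2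
  have h3 := h2.tendsto_div_nhds_zero.add_const 1
  rw [zero_add] at h3
  refine h3.congr' ?_
  filter_upwards [eventually_gt_atTop 0] with K hK
  have : (0 : ℝ) < (K : ℝ) ^ ρ := by positivity
  field_simp
  ring

theorem exists_forall_mul_sum_rpow_le {ρ : ℝ} (hρ : 0 < ρ) :
    ∃ C : ℝ, 0 ≤ C ∧ ∀ K : ℕ,
      ρ * (∑ k ∈ Finset.range K, ((k : ℝ) + 1) ^ (ρ - 1)) ≤ C * (K : ℝ) ^ ρ := by
  obtain ⟨C, hC⟩ := (tendsto_mul_sum_rpow_div_rpow hρ).bddAbove_range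
  refine ⟨max C 0, le_max_right _ _, fun K => ?_⟩
  rcases Nat.eq_zero_or_pos K with rfl | hK
  · simp [Real.zero_rpow hρ.ne']
  · rw [← div_le_iff₀ (by positivity)]
    exact (hC ⟨K, rfl⟩).trans (le_max_left _ _)

/-- The divisor bound. A prime power `p ^ k` contributes the factor `k + 1`, which is at most
`p ^ (ε * k)` for large `p`, and at most a constant times that for the finitely many other `p`. -/
theorem Nat.exists_card_divisors_le_mul_rpow {ε : ℝ} (hε : 0 < ε) :
    ∃ C : ℝ, ∀ n : ℕ, n ≠ 0 → (n.divisors.card : ℝ) ≤ C * (n : ℝ) ^ ε := by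
  have hlog : 0 < Real.log 2 := Real.log_pos (by norm_num)
  set A : ℝ := 1 + 1 / (ε * Real.log 2) with hA
  have hA1 : 1 ≤ A := by rw [hA]; have : 0 < 1 / (ε * Real.log 2) := by positivity
                         linarith
  obtain ⟨M, hM⟩ := exists_nat_ge ((2 : ℝ) ^ (1 / ε))
  have hsmall : ∀ p k : ℕ, 2 ≤ p → (k : ℝ) + 1 ≤ A * ((p : ℝ) ^ k) ^ ε := by
    intro p k hp
    have hp' : (2 : ℝ) ≤ p := by exact_mod_cast hp
    have h1 : ((2 : ℝ) ^ k) ^ ε ≤ ((p : ℝ) ^ k) ^ ε := by gcongr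
    have h2 : 1 + k * (ε * Real.log 2) ≤ ((2 : ℝ) ^ k) ^ ε := by
      rw [← Real.rpow_natCast, ← Real.rpow_mul (by norm_num), Real.rpow_def_of_pos (by norm_num)]
      calc _ = Real.log 2 * (k * ε) + 1 := by ring
        _ ≤ _ := Real.add_one_le_exp _
    have h3 : (k : ℝ) + 1 ≤ A * (1 + k * (ε * Real.log 2)) := by
      have : A * (1 + k * (ε * Real.log 2)) =
          1 + k + (k * (ε * Real.log 2) + 1 / (ε * Real.log 2)) := by
        rw [hA]; field_simp; ring
      rw [this]
      have : 0 ≤ k * (ε * Real.log 2) + 1 / (ε * Real.log 2) := by positivity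
      linarith
    exact h3.trans (by gcongr; exact h2.trans h1)
  have hlarge : ∀ p k : ℕ, M ≤ p → (k : ℝ) + 1 ≤ ((p : ℝ) ^ k) ^ ε := by
    intro p k hp
    have hp' : (2 : ℝ) ^ (1 / ε) ≤ p := hM.trans (by exact_mod_cast hp)
    have h1 : (2 : ℝ) ≤ (p : ℝ) ^ ε := by
      calc (2 : ℝ) = ((2 : ℝ) ^ (1 / ε)) ^ ε := by
            rw [← Real.rpow_mul (by norm_num), one_div_mul_cancel hε.ne', Real.rpow_one]
        _ ≤ _ := by gcongr
    have h2 : ((p : ℝ) ^ k) ^ ε = ((p : ℝ) ^ ε) ^ k := by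
      rw [← Real.rpow_natCast, ← Real.rpow_natCast, ← Real.rpow_mul (by positivity),
        ← Real.rpow_mul (by positivity), mul_comm]
    rw [h2]
    have h3 : (k : ℝ) + 1 ≤ 2 ^ k := by exact_mod_cast k.lt_two_pow_self
    exact h3.trans (by gcongr)
  refine ⟨A ^ M, fun n hn => ?_⟩
  have hn1 : (n : ℝ) ^ ε = ∏ p ∈ n.primeFactors, ((p : ℝ) ^ n.factorization p) ^ ε := by
    rw [Real.finsetProd_rpow _ _ (fun p _ => by positivity)]
    congr 1
    conv_lhs => rw [← Nat.prod_factorization_pow_eq_self hn]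
    rw [Finsupp.prod, Nat.support_factorization]
    push_cast
    rfl
  rw [Nat.card_divisors hn, hn1]
  push_cast
  calc ∏ p ∈ n.primeFactors, ((n.factorization p : ℝ) + 1)
      ≤ ∏ p ∈ n.primeFactors, ((if p < M then A else 1) *
          ((p : ℝ) ^ n.factorization p) ^ ε) := by
        refine Finset.prod_le_prod (fun p _ => by positivity) fun p hp => ?_
        split_ifs with h
        · exact hsmall p _ (Nat.prime_of_mem_primeFactors hp).two_le
        · rw [one_mul]; exact hlarge p _ (not_lt.1 h)
    _ = (∏ p ∈ n.primeFactors, if p < M then A else 1) *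
          ∏ p ∈ n.primeFactors, ((p : ℝ) ^ n.factorization p) ^ ε := Finset.prod_mul_distrib
    _ ≤ _ := by
        gcongr
        rw [← Finset.prod_filter, Finset.prod_const]
        refine pow_le_pow_right₀ hA1 ?_
        calc _ ≤ (Finset.range M).card := Finset.card_le_card fun p hp => by
              simpa using (Finset.mem_filter.1 hp).2
          _ = M := Finset.card_range M

theorem tendsto_rpow_mul_sum_divisors_rpow {η : ℝ} (hη : 0 < η) :
    Tendsto (fun n : ℕ => (n : ℝ) ^ (-η) * ∑ d ∈ n.divisors, (d : ℝ) ^ (-η)) atTop (𝓝 0) := by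
  obtain ⟨C, hC⟩ := Nat.exists_card_divisors_le_mul_rpow (half_pos hη)
  have h1 : Tendsto (fun n : ℕ => C * (n : ℝ) ^ (-(η / 2))) atTop (𝓝 0) := by
    have := ((tendsto_rpow_neg_atTop (half_pos hη)).comp tendsto_natCast_atTop_atTop).const_mul C
    simpa using this
  refine tendsto_of_tendsto_of_tendsto_of_le_of_le' tendsto_const_nhds h1
    (Eventually.of_forall fun n => by positivity) ?_
  filter_upwards [eventually_gt_atTop 0] with n hn
  have hn' : (0 : ℝ) < n := by exact_mod_cast hn
  have h2 : ∑ d ∈ n.divisors, (d : ℝ) ^ (-η) ≤ n.divisors.card := by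
    rw [Finset.card_eq_sum_ones]
    push_cast
    refine Finset.sum_le_sum fun d hd => ?_
    have hd1 : (1 : ℝ) ≤ d := by exact_mod_cast Nat.pos_of_mem_divisors hd
    exact Real.rpow_le_one_of_one_le_of_nonpos hd1 (by linarith)
  calc _ ≤ (n : ℝ) ^ (-η) * (C * (n : ℝ) ^ (η / 2)) := by
        gcongr; exact h2.trans (hC n hn.ne')
    _ = C * ((n : ℝ) ^ (-η) * (n : ℝ) ^ (η / 2)) := by ring
    _ = _ := by rw [← Real.rpow_add hn']; congr 2; ring

/-- If the sums of an absolutely summable family over the multiples of `d` vanish for all `d`, then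
the family vanishes. Inclusion and exclusion over a finite set `T` of primes shows that the sum over
the `m` with `k ∣ m` and `k * p ∤ m` for `p ∈ T` vanishes as well; as `T` grows, only the term with
`m = k` survives. -/
theorem eq_zero_of_forall_tsum_multiples_eq_zero {y : ℕ+ → ℂ} (hy : Summable fun m => ‖y m‖)
    (h : ∀ d : ℕ+, ∑' m : ℕ+, (if (d : ℕ) ∣ m then y m else 0) = 0) (k : ℕ+) : y k = 0 := by
  classical
  let P : Finset ℕ → ℕ → ℕ → Prop := fun T k m => k ∣ m ∧ ∀ p ∈ T, p.Prime → ¬ k * p ∣ m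
  have hsum : ∀ (Q : ℕ+ → Prop) [DecidablePred Q], Summable fun m => if Q m then y m else 0 := by
    intro Q _
    refine Summable.of_norm_bounded hy fun m => ?_
    split_ifs <;> simp
  have hsieve : ∀ (T : Finset ℕ) (k : ℕ+), ∑' m : ℕ+, (if P T k m then y m else 0) = 0 := by
    intro T
    induction T using Finset.induction_on with
    | empty => intro k; simpa [P] using h k
    | insert q T hq ih =>
      intro k
      by_cases hqp : q.Prime
      swap
      · have h0 : ∀ m, P (insert q T) k m ↔ P T k m := fun m => by simp [P, hqp]
        simpa only [h0] using ih k
      have h1 := ih k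
      have h2 : ∑' m : ℕ+, (if P T (k * q) m then y m else 0) = 0 := by
        let q' : ℕ+ := ⟨q, hqp.pos⟩
        have := ih (k * q')
        rwa [PNat.mul_coe] at this
      have h3 : ∀ m : ℕ, P (insert q T) k m ↔ P T k m ∧ ¬ P T (k * q) m := by
        intro m
        have hT : (∀ p ∈ T, p.Prime → ¬ (k * p : ℕ) ∣ m) →
            ∀ p ∈ T, p.Prime → ¬ (k * q : ℕ) * p ∣ m := fun hk p hp hpp hd =>
          hk p hp hpp ((Dvd.intro q (by ring)).trans hd)
        simp only [P, Finset.forall_mem_insert]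
        tauto
      have h4 : ∀ m : ℕ, P T (k * q) m → P T k m := by
        rintro m ⟨hm, hm'⟩
        exact ⟨(Dvd.intro _ rfl).trans hm, fun p hp hpp hd => hm' p hp hpp (by
          have hcop : Nat.Coprime q p := (Nat.coprime_primes hqp hpp).2 fun e => hq (e ▸ hp)
          obtain ⟨a, rfl⟩ := (Dvd.intro _ rfl).trans hm
          rw [mul_assoc]
          exact mul_dvd_mul_left _ (hcop.mul_dvd_of_dvd_of_dvd
            (Nat.dvd_of_mul_dvd_mul_left k.pos hm) (Nat.dvd_of_mul_dvd_mul_left k.pos hd)))⟩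
      have h5 : ∀ m : ℕ+, (if P (insert q T) k m then y m else 0) =
          (if P T k m then y m else 0) - (if P T (k * q) m then y m else 0) := by
        intro m
        have := h3 m
        have := h4 m
        by_cases hm : P T k m <;> by_cases hm' : P T (k * q) m <;> simp_all
      rw [tsum_congr h5, (hsum (fun m => P T k m)).tsum_sub
        (hsum (fun m => P T (k * q) m)), h1, h2, sub_zero]
  have hlim : Tendsto (fun T : Finset ℕ => ∑' m : ℕ+, (if P T k m then y m else 0)) atTop
      (𝓝 (∑' m : ℕ+, if m = k then y m else 0)) := by
    refine tendsto_tsum_of_dominated_convergence hy (fun m => ?_)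
      (Eventually.of_forall fun T m => by split_ifs <;> simp)
    refine tendsto_const_nhds.congr' ?_
    rcases eq_or_ne m k with rfl | hmk
    · refine Eventually.of_forall fun T => ?_
      have : P T m m := ⟨dvd_rfl, fun p _ hp hd => by
        have := Nat.le_of_dvd m.pos hd
        have := hp.two_le
        nlinarith [m.pos]⟩
      simp [this]
    · by_cases hkm : (k : ℕ) ∣ m
      · obtain ⟨a, ha⟩ := hkm
        have ha1 : a ≠ 1 := by
          rintro rfl
          exact hmk (PNat.eq (by simpa using ha))
        filter_upwards [eventually_ge_atTop ({a.minFac} : Finset ℕ)] with T hT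
        rw [if_neg hmk, if_neg]
        rintro ⟨-, h2⟩
        refine h2 a.minFac (hT (Finset.mem_singleton_self _)) (Nat.minFac_prime ha1) ?_
        rw [ha]
        exact mul_dvd_mul_left _ a.minFac_dvd
      · exact Eventually.of_forall fun T => by simp [P, hkm, hmk]
  simp only [hsieve] at hlim
  have := tendsto_nhds_unique hlim tendsto_const_nhds
  simpa [tsum_ite_eq] using this

/-! ### The entries of the truncated matrices and of `E(σ, 1)` -/

noncomputable section

/-- The `(n, m)` entry of `ρ * N ^ (-ρ) * Tᴴ * T`, where `T` is the `N × N` truncated multiplicative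
Toeplitz matrix with the coefficients `n ^ (-σ)` and `ρ = 1 - 2 * σ`. It vanishes unless
`[n, m] ≤ N`, so that the rows and columns beyond the `N`-th are zero. -/
def truncGramEntry (σ : ℝ) (N : ℕ) (n m : ℕ+) : ℝ :=
  (1 - 2 * σ) * (N : ℝ) ^ (-(1 - 2 * σ)) * (((n : ℕ) : ℝ) ^ σ * ((m : ℕ) : ℝ) ^ σ *
    ∑ k ∈ Finset.range (N / Nat.lcm n m), ((Nat.lcm n m : ℝ) * ((k : ℝ) + 1)) ^ (-2 * σ))

end

theorem truncGramEntry_comm (σ : ℝ) (N : ℕ) (n m : ℕ+) :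
    truncGramEntry σ N n m = truncGramEntry σ N m n := by
  rw [truncGramEntry, truncGramEntry, Nat.lcm_comm, mul_comm (((n : ℕ) : ℝ) ^ σ)]

theorem arithEntry_nonneg (σ τ : ℝ) (n m : ℕ+) : 0 ≤ arithEntry σ τ n m := by
  rw [arithEntry]; positivity

theorem truncGramEntry_nonneg {σ : ℝ} (hσ : σ < 1 / 2) (N : ℕ) (n m : ℕ+) :
    0 ≤ truncGramEntry σ N n m := by
  have : 0 < 1 - 2 * σ := by linarith
  rw [truncGramEntry]; positivity

theorem PNat.cast_lcm_pos (n m : ℕ+) : (0 : ℝ) < (Nat.lcm n m : ℕ) := by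
  exact_mod_cast Nat.lcm_pos n.pos m.pos

theorem truncGramEntry_eq (σ : ℝ) (N : ℕ) (n m : ℕ+) :
    truncGramEntry σ N n m = arithEntry σ 1 n m * ((Nat.lcm n m : ℝ) ^ (1 - 2 * σ) *
      (N : ℝ) ^ (-(1 - 2 * σ)) * ((1 - 2 * σ) *
        ∑ k ∈ Finset.range (N / Nat.lcm n m), ((k : ℝ) + 1) ^ ((1 - 2 * σ) - 1))) := by
  have hl := PNat.cast_lcm_pos n m
  have h1 : ∀ k : ℕ, ((Nat.lcm n m : ℝ) * ((k : ℝ) + 1)) ^ (-2 * σ) =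
      (Nat.lcm n m : ℝ) ^ (-2 * σ) * ((k : ℝ) + 1) ^ ((1 - 2 * σ) - 1) := by
    intro k
    rw [Real.mul_rpow hl.le (by positivity)]
    congr 2; ring
  have h2 : (Nat.lcm n m : ℝ) ^ (1 - 2 * σ) = (Nat.lcm n m : ℝ) * (Nat.lcm n m : ℝ) ^ (-2 * σ) := by
    rw [show 1 - 2 * σ = 1 + -2 * σ by ring, Real.rpow_add hl, Real.rpow_one]
  rw [truncGramEntry, arithEntry, Real.rpow_one, h2]
  simp only [h1, ← Finset.mul_sum]
  field_simp

theorem exists_truncGramEntry_le {σ : ℝ} (hσ : σ < 1 / 2) :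
    ∃ C : ℝ, 0 ≤ C ∧ ∀ N n m, truncGramEntry σ N n m ≤ C * arithEntry σ 1 n m := by
  have hρ : 0 < 1 - 2 * σ := by linarith
  obtain ⟨C, hC0, hC⟩ := exists_forall_mul_sum_rpow_le hρ
  refine ⟨C, hC0, fun N n m => ?_⟩
  have hl := PNat.cast_lcm_pos n m
  rw [truncGramEntry_eq, mul_comm C]
  refine mul_le_mul_of_nonneg_left ?_ (arithEntry_nonneg _ _ _ _)
  have h1 : ((N / Nat.lcm n m : ℕ) : ℝ) ^ (1 - 2 * σ) ≤
      (N : ℝ) ^ (1 - 2 * σ) * (Nat.lcm n m : ℝ) ^ (-(1 - 2 * σ)) := by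
    rw [Real.rpow_neg hl.le, ← div_eq_mul_inv, ← Real.div_rpow (by positivity) hl.le]
    gcongr
    exact Nat.cast_div_le
  calc _ ≤ (Nat.lcm n m : ℝ) ^ (1 - 2 * σ) * (N : ℝ) ^ (-(1 - 2 * σ)) *
        (C * ((N : ℝ) ^ (1 - 2 * σ) * (Nat.lcm n m : ℝ) ^ (-(1 - 2 * σ)))) := by
        exact mul_le_mul_of_nonneg_left
          ((hC _).trans (mul_le_mul_of_nonneg_left h1 hC0)) (by positivity)
    _ = C * ((Nat.lcm n m : ℝ) ^ (1 - 2 * σ) * (Nat.lcm n m : ℝ) ^ (-(1 - 2 * σ))) *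
        ((N : ℝ) ^ (-(1 - 2 * σ)) * (N : ℝ) ^ (1 - 2 * σ)) := by ring
    _ ≤ C * 1 * 1 := by
        gcongr
        · rw [← Real.rpow_add hl]; simp
        · rcases Nat.eq_zero_or_pos N with rfl | hN
          · simp [Real.zero_rpow hρ.ne']
          · rw [← Real.rpow_add (by exact_mod_cast hN)]; simp
    _ = C := by ring

theorem tendsto_truncGramEntry {σ : ℝ} (hσ : σ < 1 / 2) (n m : ℕ+) :
    Tendsto (fun N => truncGramEntry σ N n m) atTop (𝓝 (arithEntry σ 1 n m)) := by
  have hρ : 0 < 1 - 2 * σ := by linarith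
  have hl := PNat.cast_lcm_pos n m
  set l := Nat.lcm n m with hldef
  have hl' : 0 < l := by exact_mod_cast hl
  have h1 : Tendsto (fun N : ℕ => N / l) atTop atTop := Nat.tendsto_div_const_atTop hl'.ne'
  have h2 := (tendsto_mul_sum_rpow_div_rpow hρ).comp h1
  have h3 : Tendsto (fun N : ℕ => ((N / l : ℕ) : ℝ) / N) atTop (𝓝 (l : ℝ)⁻¹) := by
    have := (tendsto_nat_floor_mul_div_atTop (R := ℝ) (a := (l : ℝ)⁻¹) (by positivity)).comp
      tendsto_natCast_atTop_atTop
    refine this.congr fun N => ?_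
    simp only [Function.comp_apply]
    rw [inv_mul_eq_div, Nat.floor_div_natCast, Nat.floor_natCast]
  have h4 := h3.rpow_const (p := 1 - 2 * σ) (Or.inr hρ.le)
  have h5 := (h2.mul h4).const_mul (arithEntry σ 1 n m * (l : ℝ) ^ (1 - 2 * σ))
  have h6 : arithEntry σ 1 n m * (l : ℝ) ^ (1 - 2 * σ) * (1 * (l : ℝ)⁻¹ ^ (1 - 2 * σ)) =
      arithEntry σ 1 n m := by
    rw [Real.inv_rpow hl.le]
    have := (Real.rpow_pos_of_pos hl (1 - 2 * σ)).ne'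
    field_simp
  rw [h6] at h5
  refine h5.congr' ?_
  filter_upwards [eventually_gt_atTop 0, h1.eventually_gt_atTop 0] with N hN hK
  have hN' : (0 : ℝ) < N := by exact_mod_cast hN
  have hK' : (0 : ℝ) < ((N / l : ℕ) : ℝ) := by exact_mod_cast hK
  rw [truncGramEntry_eq, ← hldef]
  simp only [Function.comp_apply]
  rw [Real.div_rpow hK'.le hN'.le, Real.rpow_neg hN'.le]
  have e1 := (Real.rpow_pos_of_pos hK' (1 - 2 * σ)).ne'
  have e2 := (Real.rpow_pos_of_pos hN' (1 - 2 * σ)).ne'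
  field_simp

/-- `n ^ σ * m ^ σ / [n, m]` in terms of the greatest common divisor. -/
theorem arithEntry_one_eq_gcd (σ : ℝ) (n m : ℕ+) :
    arithEntry σ 1 n m = ((n : ℕ) : ℝ) ^ (σ - 1) *
      ((Nat.gcd n m : ℝ) * ((m : ℕ) : ℝ) ^ (σ - 1)) := by
  have hn : (0 : ℝ) < (n : ℕ) := by exact_mod_cast n.pos
  have hm : (0 : ℝ) < (m : ℕ) := by exact_mod_cast m.pos
  have hl := PNat.cast_lcm_pos n m
  have h : ((Nat.gcd n m : ℕ) : ℝ) * (Nat.lcm n m : ℕ) = (n : ℕ) * (m : ℕ) := by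
    exact_mod_cast Nat.gcd_mul_lcm n m
  rw [arithEntry, Real.rpow_one, Real.rpow_sub_one hn.ne', Real.rpow_sub_one hm.ne',
    div_eq_iff hl.ne']
  field_simp
  exact h.symm

theorem sum_filter_dvd_rpow_le {a : ℝ} (ha : 1 < a) (d : ℕ) (hd : 0 < d) (s : Finset ℕ+) :
    ∑ m ∈ s with d ∣ ((m : ℕ+) : ℕ), ((m : ℕ) : ℝ) ^ (-a) ≤
      (d : ℝ) ^ (-a) * ∑' k : ℕ, (k : ℝ) ^ (-a) := by
  have hs : Summable fun k : ℕ => (k : ℝ) ^ (-a) := Real.summable_nat_rpow.2 (by linarith)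
  have h1 : ∑ m ∈ s with d ∣ ((m : ℕ+) : ℕ), ((m : ℕ) : ℝ) ^ (-a) =
      (d : ℝ) ^ (-a) * ∑ m ∈ s with d ∣ ((m : ℕ+) : ℕ), (((m : ℕ) / d : ℕ) : ℝ) ^ (-a) := by
    rw [Finset.mul_sum]
    refine Finset.sum_congr rfl fun m hm => ?_
    obtain ⟨k, hk⟩ := (Finset.mem_filter.1 hm).2
    rw [hk, Nat.mul_div_cancel_left _ hd]
    push_cast
    exact Real.mul_rpow (by positivity) (by positivity)
  rw [h1]
  gcongr
  rw [← Finset.sum_image (f := fun k : ℕ => (k : ℝ) ^ (-a)) (g := fun m : ℕ+ => (m : ℕ) / d)]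
  · exact hs.sum_le_tsum _ fun k _ => by positivity
  · intro x hx y hy hxy
    have hx' := (Finset.mem_filter.1 hx).2
    have hy' := (Finset.mem_filter.1 hy).2
    exact PNat.eq ((Nat.div_left_inj hx' hy').1 hxy)

/-- The Schur sums of `E(σ, 1)` for the weight `m ^ (-1/2)`, where the exponent `-1/2` lies in
the interval `(σ - 1, -σ)`: below `-σ` the sums over `m` converge, and above `σ - 1` they decay
relative to the weight as `n → ∞`. -/
theorem sum_arithEntry_mul_rpow_le {σ : ℝ} (hσ : σ < 1 / 2) (s : Finset ℕ+) (n : ℕ+) :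
    ∑ m ∈ s, arithEntry σ 1 n m * ((m : ℕ) : ℝ) ^ (-(1 / 2) : ℝ) ≤
      (∑' k : ℕ, (k : ℝ) ^ (-(3 / 2 - σ))) * (((n : ℕ) : ℝ) ^ (-(1 / 2 - σ)) *
        ∑ d ∈ (n : ℕ).divisors, (d : ℝ) ^ (-(1 / 2 - σ))) * ((n : ℕ) : ℝ) ^ (-(1 / 2) : ℝ) := by
  have hn : (0 : ℝ) < (n : ℕ) := by exact_mod_cast n.pos
  set Z := ∑' k : ℕ, (k : ℝ) ^ (-(3 / 2 - σ)) with hZ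
  have h1 : ∀ m : ℕ+, arithEntry σ 1 n m * ((m : ℕ) : ℝ) ^ (-(1 / 2) : ℝ) =
      ((n : ℕ) : ℝ) ^ (σ - 1) * ((Nat.gcd n m : ℝ) * ((m : ℕ) : ℝ) ^ (-(3 / 2 - σ))) := by
    intro m
    have hm : (0 : ℝ) < (m : ℕ) := by exact_mod_cast m.pos
    rw [arithEntry_one_eq_gcd, mul_assoc, mul_assoc, ← Real.rpow_add hm]
    congr 4; ring
  have h2 : ∀ m : ℕ+, (Nat.gcd n m : ℝ) ≤
      ∑ d ∈ (n : ℕ).divisors, if d ∣ (m : ℕ) then (d : ℝ) else 0 := by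
    intro m
    have hg : Nat.gcd n m ∈ (n : ℕ).divisors :=
      Nat.mem_divisors.2 ⟨Nat.gcd_dvd_left _ _, n.pos.ne'⟩
    refine le_trans ?_ (Finset.single_le_sum (f := fun d : ℕ => if d ∣ (m : ℕ) then (d : ℝ) else 0)
      (fun d _ => by positivity) hg)
    rw [if_pos (Nat.gcd_dvd_right _ _)]
  simp only [h1, ← Finset.mul_sum]
  have h3 : ∑ m ∈ s, (Nat.gcd n m : ℝ) * ((m : ℕ) : ℝ) ^ (-(3 / 2 - σ)) ≤
      Z * ∑ d ∈ (n : ℕ).divisors, (d : ℝ) ^ (-(1 / 2 - σ)) := by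
    calc _ ≤ ∑ m ∈ s, ∑ d ∈ (n : ℕ).divisors,
          (if d ∣ (m : ℕ) then (d : ℝ) else 0) * ((m : ℕ) : ℝ) ^ (-(3 / 2 - σ)) := by
          refine Finset.sum_le_sum fun m _ => ?_
          rw [← Finset.sum_mul]
          gcongr
          exact h2 m
      _ = ∑ d ∈ (n : ℕ).divisors, (d : ℝ) *
          ∑ m ∈ s with d ∣ ((m : ℕ+) : ℕ), ((m : ℕ) : ℝ) ^ (-(3 / 2 - σ)) := by
          rw [Finset.sum_comm]
          refine Finset.sum_congr rfl fun d _ => ?_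
          rw [Finset.mul_sum, Finset.sum_filter]
          refine Finset.sum_congr rfl fun m _ => ?_
          split_ifs <;> simp
      _ ≤ ∑ d ∈ (n : ℕ).divisors, (d : ℝ) * ((d : ℝ) ^ (-(3 / 2 - σ)) * Z) := by
          refine Finset.sum_le_sum fun d hd => ?_
          gcongr
          exact sum_filter_dvd_rpow_le (by linarith) d (Nat.pos_of_mem_divisors hd) s
      _ = _ := by
          rw [Finset.mul_sum]
          refine Finset.sum_congr rfl fun d hd => ?_
          have hd' : (0 : ℝ) < d := by exact_mod_cast Nat.pos_of_mem_divisors hd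
          rw [← mul_assoc, ← Real.rpow_one_add' hd'.le (by linarith), mul_comm]
          congr 2; ring
  calc _ ≤ ((n : ℕ) : ℝ) ^ (σ - 1) * (Z * ∑ d ∈ (n : ℕ).divisors, (d : ℝ) ^ (-(1 / 2 - σ))) := by
        gcongr
    _ = _ := by
        have : ((n : ℕ) : ℝ) ^ (σ - 1) =
            ((n : ℕ) : ℝ) ^ (-(1 / 2 - σ)) * ((n : ℕ) : ℝ) ^ (-(1 / 2) : ℝ) := by
          rw [← Real.rpow_add hn]; congr 1; ring
        rw [this]; ring

/-- The Schur sums of the difference of the truncated matrix and `E(σ, 1)` tend to zero uniformly.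
For large `n` they are dominated by those of `E(σ, 1)`, which tend to zero as `n → ∞`; for each of
the remaining finitely many `n`, dominated convergence applies. -/
theorem eventually_sum_truncGramEntry_sub_le {σ : ℝ} (hσ : σ < 1 / 2) {δ : ℝ} (hδ : 0 < δ) :
    ∀ᶠ N in atTop, ∀ (s : Finset ℕ+) (n : ℕ+),
      ∑ m ∈ s, |truncGramEntry σ N n m - arithEntry σ 1 n m| * ((m : ℕ) : ℝ) ^ (-(1 / 2) : ℝ) ≤
        δ * ((n : ℕ) : ℝ) ^ (-(1 / 2) : ℝ) := by
  obtain ⟨C, hC0, hC⟩ := exists_truncGramEntry_le hσ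
  have hdom : ∀ N n m, |truncGramEntry σ N n m - arithEntry σ 1 n m| ≤
      (C + 1) * arithEntry σ 1 n m := by
    intro N n m
    have h1 := truncGramEntry_nonneg hσ N n m
    have h2 := arithEntry_nonneg σ 1 n m
    have h3 := hC N n m
    have h4 : 0 ≤ C * arithEntry σ 1 n m := by positivity
    rw [abs_le]; constructor <;> linarith
  set Z := ∑' k : ℕ, (k : ℝ) ^ (-(3 / 2 - σ)) with hZ
  have hlim := (tendsto_rpow_mul_sum_divisors_rpow (η := 1 / 2 - σ) (by linarith)).const_mul
    ((C + 1) * Z)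
  rw [mul_zero] at hlim
  obtain ⟨K, hK⟩ := eventually_atTop.1 (hlim.eventually_lt_const hδ)
  have hlarge : ∀ (N : ℕ) (s : Finset ℕ+) (n : ℕ+), K ≤ n →
      ∑ m ∈ s, |truncGramEntry σ N n m - arithEntry σ 1 n m| * ((m : ℕ) : ℝ) ^ (-(1 / 2) : ℝ) ≤
        δ * ((n : ℕ) : ℝ) ^ (-(1 / 2) : ℝ) := by
    intro N s n hn
    calc _ ≤ ∑ m ∈ s, (C + 1) * (arithEntry σ 1 n m * ((m : ℕ) : ℝ) ^ (-(1 / 2) : ℝ)) := by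
          refine Finset.sum_le_sum fun m _ => ?_
          rw [← mul_assoc]
          gcongr
          exact hdom N n m
      _ ≤ (C + 1) * (Z * (((n : ℕ) : ℝ) ^ (-(1 / 2 - σ)) *
            ∑ d ∈ (n : ℕ).divisors, (d : ℝ) ^ (-(1 / 2 - σ))) *
              ((n : ℕ) : ℝ) ^ (-(1 / 2) : ℝ)) := by
          rw [← Finset.mul_sum]
          gcongr
          exact sum_arithEntry_mul_rpow_le hσ s n
      _ = (C + 1) * Z * (((n : ℕ) : ℝ) ^ (-(1 / 2 - σ)) *
            ∑ d ∈ (n : ℕ).divisors, (d : ℝ) ^ (-(1 / 2 - σ))) * ((n : ℕ) : ℝ) ^ (-(1 / 2) : ℝ) := by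
          ring
      _ ≤ _ := by
          gcongr
          exact (hK n hn).le
  have hsmall : ∀ n : ℕ+, ∀ᶠ N in atTop, ∀ s : Finset ℕ+,
      ∑ m ∈ s, |truncGramEntry σ N n m - arithEntry σ 1 n m| * ((m : ℕ) : ℝ) ^ (-(1 / 2) : ℝ) ≤
        δ * ((n : ℕ) : ℝ) ^ (-(1 / 2) : ℝ) := by
    intro n
    have hn : (0 : ℝ) < (n : ℕ) := by exact_mod_cast n.pos
    have hsum : Summable fun m : ℕ+ => arithEntry σ 1 n m * ((m : ℕ) : ℝ) ^ (-(1 / 2) : ℝ) :=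
      summable_of_sum_le (fun m => mul_nonneg (arithEntry_nonneg _ _ _ _) (by positivity))
        (fun s => sum_arithEntry_mul_rpow_le hσ s n)
    have hsum' := hsum.mul_left (C + 1)
    have hle : ∀ N m, |truncGramEntry σ N n m - arithEntry σ 1 n m| *
        ((m : ℕ) : ℝ) ^ (-(1 / 2) : ℝ) ≤
          (C + 1) * (arithEntry σ 1 n m * ((m : ℕ) : ℝ) ^ (-(1 / 2) : ℝ)) := by
      intro N m
      rw [← mul_assoc]
      gcongr
      exact hdom N n m
    have h0 : ∀ N m, 0 ≤ |truncGramEntry σ N n m - arithEntry σ 1 n m| *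
        ((m : ℕ) : ℝ) ^ (-(1 / 2) : ℝ) := fun N m => by positivity
    have hT : Tendsto (fun N => ∑' m : ℕ+, |truncGramEntry σ N n m - arithEntry σ 1 n m| *
        ((m : ℕ) : ℝ) ^ (-(1 / 2) : ℝ)) atTop (𝓝 (∑' _ : ℕ+, (0 : ℝ))) := by
      refine tendsto_tsum_of_dominated_convergence hsum' (fun m => ?_)
        (Eventually.of_forall fun N m => ?_)
      · have := ((tendsto_truncGramEntry hσ n m).sub_const (arithEntry σ 1 n m)).abs.mul_const
          (((m : ℕ) : ℝ) ^ (-(1 / 2) : ℝ))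
        simpa using this
      · rw [Real.norm_of_nonneg (h0 N m)]
        exact hle N m
    rw [tsum_zero] at hT
    have hpos : 0 < δ * ((n : ℕ) : ℝ) ^ (-(1 / 2) : ℝ) := by positivity
    filter_upwards [hT.eventually_lt_const hpos] with N hN s
    have hs : Summable fun m : ℕ+ => |truncGramEntry σ N n m - arithEntry σ 1 n m| *
        ((m : ℕ) : ℝ) ^ (-(1 / 2) : ℝ) := Summable.of_nonneg_of_le (h0 N) (hle N) hsum'
    exact (hs.sum_le_tsum s fun m _ => h0 N m).trans hN.le
  have hfin : {n : ℕ+ | (n : ℕ) < K}.Finite :=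
    (Set.finite_Iio K).preimage (PNat.coe_injective.injOn)
  filter_upwards [(Filter.eventually_all_finite hfin).2 fun n _ => hsmall n] with N hN s n
  rcases lt_or_ge (n : ℕ) K with h | h
  · exact hN n h s
  · exact hlarge N s n h

/-! ### Operators on `ℓ²(ℕ)` and their limit -/

noncomputable section

/-- The restriction of a sequence in `ℓ²(ℕ)` to its first `N` coordinates. -/
def truncRestrict (N : ℕ) : EllTwo →L[ℂ] EuclideanSpace ℂ (Fin N) :=
  ((EuclideanSpace.equiv (Fin N) ℂ).symm : (Fin N → ℂ) →L[ℂ] EuclideanSpace ℂ (Fin N)).comp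
    (ContinuousLinearMap.pi fun i : Fin N => innerSL ℂ (lp.single 2 (Nat.succPNat i) (1 : ℂ)))

/-- The rectangular operator `x ↦ T (x 1, …, x N)` from `ℓ²(ℕ)`, where `T` is the `N × N` truncated
multiplicative Toeplitz matrix with the coefficients `n ^ (-σ)`. -/
def truncToeplitz (σ : ℝ) (N : ℕ) : EllTwo →L[ℂ] EuclideanSpace ℂ (Fin N) :=
  (LinearMap.toContinuousLinearMap
    (Matrix.toEuclideanLin (truncMultToeplitz (zetaShiftCoeff σ) N))).comp (truncRestrict N)

/-- The operator `ρ * N ^ (-ρ) * Tᴴ * T` on `ℓ²(ℕ)`, where `T` is the `N × N` truncated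
multiplicative Toeplitz matrix, extended by zero, and `ρ = 1 - 2 * σ`. -/
def truncGram (σ : ℝ) (N : ℕ) : EllTwo →L[ℂ] EllTwo :=
  (((1 - 2 * σ) * (N : ℝ) ^ (-(1 - 2 * σ)) : ℝ) : ℂ) •
    (truncToeplitz σ N).adjoint.comp (truncToeplitz σ N)

end

theorem truncRestrict_apply (N : ℕ) (x : EllTwo) (i : Fin N) :
    truncRestrict N x i = x (Nat.succPNat i) := by
  simp [truncRestrict, lp.inner_single_left]

theorem norm_truncRestrict_le (N : ℕ) (x : EllTwo) : ‖truncRestrict N x‖ ≤ ‖x‖ := by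
  refine le_of_sq_le_sq ?_ (norm_nonneg _)
  rw [EuclideanSpace.norm_sq_eq]
  simp only [truncRestrict_apply]
  have hinj : Function.Injective fun i : Fin N => Nat.succPNat i := fun i j h =>
    Fin.ext (Nat.succPNat_injective h)
  have h := lp.sum_rpow_le_norm_rpow (p := 2) (by simp) x (Finset.univ.map ⟨_, hinj⟩)
  simpa using h

theorem norm_adjoint_truncRestrict_le (N : ℕ) (y : EuclideanSpace ℂ (Fin N)) :
    ‖(truncRestrict N).adjoint y‖ ≤ ‖y‖ := by
  have h1 : ‖(truncRestrict N).adjoint‖ ≤ 1 := by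
    rw [LinearIsometryEquiv.norm_map]
    exact (truncRestrict N).opNorm_le_bound zero_le_one fun x => by
      simpa using norm_truncRestrict_le N x
  simpa using (truncRestrict N).adjoint.le_of_opNorm_le h1 y

theorem truncRestrict_adjoint_truncRestrict (N : ℕ) (y : EuclideanSpace ℂ (Fin N)) :
    truncRestrict N ((truncRestrict N).adjoint y) = y := by
  ext i
  have h1 : truncRestrict N (lp.single 2 (Nat.succPNat i) (1 : ℂ)) = EuclideanSpace.single i 1 := by
    ext j
    rw [truncRestrict_apply, lp.single_apply]
    rcases eq_or_ne j i with rfl | h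
    · simp
    · have h' : Nat.succPNat (j : ℕ) ≠ Nat.succPNat i := fun e =>
        h (Fin.ext (Nat.succPNat_injective e))
      simp [h, Pi.single_eq_of_ne h']
  have h2 := ContinuousLinearMap.adjoint_inner_right (truncRestrict N)
    (lp.single 2 (Nat.succPNat i) (1 : ℂ)) y
  rw [h1, lp.inner_single_left, EuclideanSpace.inner_single_left] at h2
  rw [truncRestrict_apply]
  simpa using h2

theorem truncToeplitz_single_apply (σ : ℝ) (N : ℕ) (m : ℕ+) (i : Fin N) :
    truncToeplitz σ N (lp.single 2 m (1 : ℂ)) i =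
      if (m : ℕ) ∣ i + 1 then ((((((i : ℕ) + 1 : ℕ) : ℝ) / (m : ℕ)) ^ (-σ) : ℝ) : ℂ) else 0 := by
  have h1 : truncToeplitz σ N (lp.single 2 m (1 : ℂ)) i =
      ∑ j : Fin N, truncMultToeplitz (zetaShiftCoeff σ) N i j *
        truncRestrict N (lp.single 2 m (1 : ℂ)) j := by
    simp [truncToeplitz, Matrix.toLpLin_apply, Matrix.mulVec, dotProduct]
  rw [h1]
  simp only [truncRestrict_apply, lp.single_apply]
  by_cases hm : (m : ℕ) ≤ N
  · let j₀ : Fin N := ⟨m - 1, by have := m.pos; omega⟩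
    have hj₀ : (j₀ : ℕ) + 1 = m := by have := m.pos; simp only [j₀]; omega
    rw [Finset.sum_eq_single j₀]
    · have : Nat.succPNat (j₀ : ℕ) = m := PNat.eq (by simpa using hj₀)
      rw [this, Pi.single_eq_same, mul_one, truncMultToeplitz, hj₀]
      split_ifs with hd
      · rw [zetaShiftCoeff, Nat.cast_div hd (by exact_mod_cast m.pos.ne')]
      · rfl
    · intro j _ hj
      have : Nat.succPNat (j : ℕ) ≠ m := fun h => hj (Fin.ext (by
        have := congrArg PNat.val h
        simp only [Nat.succPNat_coe, Nat.succ_eq_add_one] at this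
        omega))
      rw [Pi.single_eq_of_ne this, mul_zero]
    · simp
  · have h2 : ¬ (m : ℕ) ∣ i + 1 := fun h => hm ((Nat.le_of_dvd (by omega) h).trans i.2)
    rw [if_neg h2]
    refine Finset.sum_eq_zero fun j _ => ?_
    have : Nat.succPNat (j : ℕ) ≠ m := fun h => hm (by
      have := congrArg PNat.val h
      simp only [Nat.succPNat_coe, Nat.succ_eq_add_one] at this
      have := j.2
      change (m : ℕ) ≤ N
      omega)
    rw [Pi.single_eq_of_ne this, mul_zero]

theorem sum_range_ite_dvd_succ {M : Type*} [AddCommMonoid M] (f : ℕ → M) (N : ℕ) {l : ℕ}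
    (hl : 0 < l) :
    ∑ i ∈ Finset.range N, (if l ∣ i + 1 then f (i + 1) else 0) =
      ∑ k ∈ Finset.range (N / l), f (l * (k + 1)) := by
  rw [← Finset.sum_filter]
  symm
  refine Finset.sum_nbij (fun k => l * (k + 1) - 1) ?_ ?_ ?_ ?_
  · intro k hk
    have h1 : k + 1 ≤ N / l := Finset.mem_range.1 hk
    have h2 : l * (k + 1) ≤ N := by
      rw [mul_comm]; exact (Nat.le_div_iff_mul_le hl).1 h1
    have h3 : 0 < l * (k + 1) := by positivity
    rw [Finset.mem_filter, Finset.mem_range]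
    exact ⟨by omega, by rw [Nat.sub_add_cancel h3]; exact Dvd.intro _ rfl⟩
  · intro a _ b _ hab
    have h1 : 0 < l * (a + 1) := by positivity
    have h2 : 0 < l * (b + 1) := by positivity
    have h3 : l * (a + 1) = l * (b + 1) := by
      simp only at hab
      omega
    have := Nat.eq_of_mul_eq_mul_left hl h3
    omega
  · intro i hi
    obtain ⟨hi1, k, hk⟩ := Finset.mem_filter.1 hi
    have hk0 : 0 < k := Nat.pos_of_ne_zero (by rintro rfl; omega)
    have hiN := Finset.mem_range.1 hi1
    refine ⟨k - 1, Finset.mem_coe.2 (Finset.mem_range.2 ?_), ?_⟩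
    · have : k ≤ N / l := (Nat.le_div_iff_mul_le hl).2 (by rw [mul_comm]; omega)
      omega
    · simp only
      rw [Nat.sub_add_cancel hk0, ← hk]; omega
  · intro k _
    have h3 : 0 < l * (k + 1) := by positivity
    rw [Nat.sub_add_cancel h3]

theorem hasInfiniteMatrix_truncGram (σ : ℝ) (N : ℕ) :
    HasInfiniteMatrix (truncGram σ N) (truncGramEntry σ N) := by
  intro n m
  have h0 : (truncGram σ N (lp.single 2 m (1 : ℂ)) : ℕ+ → ℂ) n =
      ⟪lp.single 2 n (1 : ℂ), truncGram σ N (lp.single 2 m (1 : ℂ))⟫_ℂ := by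
    rw [lp.inner_single_left]; simp
  rw [h0, truncGram, _root_.smul_apply, inner_smul_right,
    ContinuousLinearMap.comp_apply, ContinuousLinearMap.adjoint_inner_right, PiLp.inner_apply,
    truncGramEntry, Complex.ofReal_mul ((1 - 2 * σ) * (N : ℝ) ^ (-(1 - 2 * σ)))]
  congr 1
  simp only [truncToeplitz_single_apply]
  let F : ℕ → ℂ := fun j => ((((n : ℕ) : ℝ) ^ σ * ((m : ℕ) : ℝ) ^ σ * (j : ℝ) ^ (-2 * σ) : ℝ) : ℂ)
  have h1 : ∀ i : Fin N, ⟪(if (n : ℕ) ∣ i + 1 then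
        ((((((i : ℕ) + 1 : ℕ) : ℝ) / (n : ℕ)) ^ (-σ) : ℝ) : ℂ) else 0),
      (if (m : ℕ) ∣ i + 1 then ((((((i : ℕ) + 1 : ℕ) : ℝ) / (m : ℕ)) ^ (-σ) : ℝ) : ℂ) else 0)⟫_ℂ =
      if Nat.lcm n m ∣ (i : ℕ) + 1 then F (i + 1) else 0 := by
    intro i
    have hlcm : Nat.lcm n m ∣ (i : ℕ) + 1 ↔ (n : ℕ) ∣ i + 1 ∧ (m : ℕ) ∣ i + 1 := Nat.lcm_dvd_iff
    simp only [hlcm]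
    by_cases hn : (n : ℕ) ∣ i + 1 <;> by_cases hm : (m : ℕ) ∣ i + 1 <;>
      simp only [hn, hm, and_self, and_true, and_false, if_true, if_false, inner_zero_left,
        inner_zero_right]
    have hi : (0 : ℝ) < (((i : ℕ) + 1 : ℕ) : ℝ) := by positivity
    have hn' : (0 : ℝ) < (n : ℕ) := by exact_mod_cast n.pos
    have hm' : (0 : ℝ) < (m : ℕ) := by exact_mod_cast m.pos
    rw [RCLike.inner_apply, Complex.conj_ofReal, ← Complex.ofReal_mul]
    congr 1
    rw [Real.div_rpow hi.le hn'.le, Real.div_rpow hi.le hm'.le, Real.rpow_neg hn'.le,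
      Real.rpow_neg hm'.le, show -2 * σ = -σ + -σ by ring, Real.rpow_add hi]
    field_simp
  rw [Finset.sum_congr rfl fun i _ => h1 i,
    Fin.sum_univ_eq_sum_range (fun i : ℕ => if Nat.lcm n m ∣ i + 1 then F (i + 1) else 0) N,
    sum_range_ite_dvd_succ F N (Nat.lcm_pos n.pos m.pos), ← Complex.ofReal_sum, Finset.mul_sum]
  push_cast
  rfl

theorem re_inner_truncGram (σ : ℝ) (N : ℕ) (x : EllTwo) :
    (⟪x, truncGram σ N x⟫_ℂ).re =
      (1 - 2 * σ) * (N : ℝ) ^ (-(1 - 2 * σ)) * ‖truncToeplitz σ N x‖ ^ 2 := by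
  rw [truncGram, _root_.smul_apply, inner_smul_right, ContinuousLinearMap.comp_apply,
    ContinuousLinearMap.adjoint_inner_right, inner_self_eq_norm_sq_to_K, Complex.re_ofReal_mul]
  norm_cast

theorem isPositive_truncGram {σ : ℝ} (hσ : σ < 1 / 2) (N : ℕ) : (truncGram σ N).IsPositive := by
  have : 0 < 1 - 2 * σ := by linarith
  refine (ContinuousLinearMap.isPositive_adjoint_comp_self (truncToeplitz σ N)).smul_of_nonneg ?_
  exact_mod_cast (by positivity : 0 ≤ (1 - 2 * σ) * (N : ℝ) ^ (-(1 - 2 * σ)))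

theorem isCompactOperator_truncGram (σ : ℝ) (N : ℕ) : IsCompactOperator (truncGram σ N) := by
  have h1 : IsCompactOperator (truncToeplitz σ N) :=
    isCompactOperator_of_locallyCompactSpace_dom (truncToeplitz σ N)
  exact (h1.clm_comp (truncToeplitz σ N).adjoint).smul
    (((1 - 2 * σ) * (N : ℝ) ^ (-(1 - 2 * σ)) : ℝ) : ℂ)

theorem norm_truncGram_sub_le {σ : ℝ} {δ : ℝ} (hδ : 0 < δ) {a b : ℕ}
    (ha : ∀ (s : Finset ℕ+) (n : ℕ+),
      ∑ m ∈ s, |truncGramEntry σ a n m - arithEntry σ 1 n m| * ((m : ℕ) : ℝ) ^ (-(1 / 2) : ℝ) ≤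
        δ * ((n : ℕ) : ℝ) ^ (-(1 / 2) : ℝ))
    (hb : ∀ (s : Finset ℕ+) (n : ℕ+),
      ∑ m ∈ s, |truncGramEntry σ b n m - arithEntry σ 1 n m| * ((m : ℕ) : ℝ) ^ (-(1 / 2) : ℝ) ≤
        δ * ((n : ℕ) : ℝ) ^ (-(1 / 2) : ℝ)) :
    ‖truncGram σ a - truncGram σ b‖ ≤ 2 * δ := by
  have hmat : HasInfiniteMatrix (truncGram σ a - truncGram σ b)
      (fun n m => truncGramEntry σ a n m - truncGramEntry σ b n m) := by
    intro n m
    rw [_root_.sub_apply, lp.coeFn_sub, Pi.sub_apply,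
      hasInfiniteMatrix_truncGram, hasInfiniteMatrix_truncGram, Complex.ofReal_sub]
  refine hmat.opNorm_le_of_sum_le (w := fun n => ((n : ℕ) : ℝ) ^ (-(1 / 2) : ℝ))
    (fun n m => by rw [truncGramEntry_comm, truncGramEntry_comm σ b])
    (fun n => Real.rpow_pos_of_pos (by exact_mod_cast n.pos) _) (by positivity) fun s n => ?_
  calc _ ≤ ∑ m ∈ s, (|truncGramEntry σ a n m - arithEntry σ 1 n m| *
        ((m : ℕ) : ℝ) ^ (-(1 / 2) : ℝ) + |truncGramEntry σ b n m - arithEntry σ 1 n m| *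
        ((m : ℕ) : ℝ) ^ (-(1 / 2) : ℝ)) := by
        refine Finset.sum_le_sum fun m _ => ?_
        rw [← add_mul]
        refine mul_le_mul_of_nonneg_right ?_ (by positivity)
        rw [abs_sub_comm (truncGramEntry σ b n m)]
        exact abs_sub_le _ _ _
    _ ≤ _ := by rw [Finset.sum_add_distrib]; linarith [ha s n, hb s n]

/-- Matrix entries pass to limits in the operator norm. -/
theorem HasInfiniteMatrix.of_tendsto {A : ℕ → EllTwo →L[ℂ] EllTwo} {E : EllTwo →L[ℂ] EllTwo}
    {a : ℕ → ℕ+ → ℕ+ → ℝ} {e : ℕ+ → ℕ+ → ℝ} (hA : ∀ N, HasInfiniteMatrix (A N) (a N))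
    (hE : Tendsto A atTop (𝓝 E)) (ha : ∀ n m, Tendsto (fun N => a N n m) atTop (𝓝 (e n m))) :
    HasInfiniteMatrix E e := by
  intro n m
  let v : EllTwo := lp.single 2 m (1 : ℂ)
  have h1 : Tendsto (fun N => A N v) atTop (𝓝 (E v)) :=
    ((ContinuousLinearMap.apply ℂ EllTwo v).continuous.tendsto E).comp hE
  have h2 := ((innerSL ℂ (lp.single (E := fun _ : ℕ+ => ℂ) 2 n (1 : ℂ))).continuous.tendsto _).comp
    h1
  have h3 : ∀ z : EllTwo, innerSL ℂ (lp.single 2 n (1 : ℂ)) z = z n := fun z => by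
    rw [innerSL_apply_apply, lp.inner_single_left]; simp
  have h4 : Tendsto (fun N => (a N n m : ℂ)) atTop (𝓝 (E (lp.single 2 m (1 : ℂ)) n)) := by
    refine (h2.congr fun N => ?_).trans_eq (by rw [h3])
    rw [Function.comp_apply, h3, hA N n m]
  exact tendsto_nhds_unique h4 ((Complex.continuous_ofReal.tendsto _).comp (ha n m))

theorem cauchySeq_truncGram {σ : ℝ} (hσ : σ < 1 / 2) : CauchySeq (truncGram σ) := by
  refine Metric.cauchySeq_iff.2 fun ε hε => ?_
  obtain ⟨N₀, hN₀⟩ := eventually_atTop.1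
    (eventually_sum_truncGramEntry_sub_le hσ (δ := ε / 4) (by positivity))
  refine ⟨N₀, fun a ha b hb => ?_⟩
  rw [dist_eq_norm]
  have := norm_truncGram_sub_le (by positivity) (hN₀ a ha) (hN₀ b hb)
  linarith

/-- By Schur's test the operators `ρ * N ^ (-ρ) * Tᴴ * T` converge in the operator norm; the limit
has the matrix `E(σ, 1)`. -/
theorem exists_tendsto_truncGram {σ : ℝ} (hσ : σ < 1 / 2) :
    ∃ E : EllTwo →L[ℂ] EllTwo, HasInfiniteMatrix E (arithEntry σ 1) ∧
      Tendsto (truncGram σ) atTop (𝓝 E) := by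
  obtain ⟨E, hE⟩ := cauchySeq_tendsto_of_complete (cauchySeq_truncGram hσ)
  exact ⟨E, .of_tendsto (hasInfiniteMatrix_truncGram σ) hE (tendsto_truncGramEntry hσ), hE⟩

/-- `E(σ, 1)` is injective. If `E(σ, 1) x = 0` and `y m = m ^ (σ - 1) * x m`, then the sums of
`gcd(n, m) * y m` over `m` vanish. As `gcd(n, m)` is the sum of `φ d` over the common divisors `d`,
so do the sums of `y` over the multiples of each `d`. -/
theorem HasInfiniteMatrix.eq_zero_of_apply_eq_zero {σ : ℝ} (hσ : σ < 1 / 2)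
    {E : EllTwo →L[ℂ] EllTwo} (hE : HasInfiniteMatrix E (arithEntry σ 1)) {x : EllTwo}
    (hx : E x = 0) : x = 0 := by
  have hpos : ∀ n : ℕ+, (0 : ℝ) < ((n : ℕ) : ℝ) ^ (σ - 1) := fun n =>
    Real.rpow_pos_of_pos (by exact_mod_cast n.pos) _
  -- The family `y` is absolutely summable, as `σ < 1 / 2` makes `m ^ (σ - 1)` square summable.
  let y : ℕ+ → ℂ := fun m => ((((m : ℕ) : ℝ) ^ (σ - 1) : ℝ) : ℂ) * x m
  have hy : Summable fun m => ‖y m‖ := by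
    have h1 : Summable fun m : ℕ+ => ((m : ℕ) : ℝ) ^ (2 * (σ - 1)) :=
      (Real.summable_nat_rpow.2 (by linarith : 2 * (σ - 1) < -1)).comp_injective
        PNat.coe_injective
    have h2 : Summable fun m : ℕ+ => ‖x m‖ ^ 2 := by
      simpa using (lp.memℓp x).summable (by simp)
    refine Summable.of_nonneg_of_le (fun m => norm_nonneg _) (fun m => ?_) (h1.add h2)
    have hm : (0 : ℝ) ≤ (m : ℕ) := by positivity
    rw [mul_comm (2 : ℝ), Real.rpow_mul hm]
    simp only [y, norm_mul, Complex.norm_real, Real.norm_of_nonneg (hpos m).le, Real.rpow_ofNat]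
    nlinarith [sq_nonneg (((m : ℕ) : ℝ) ^ (σ - 1) - ‖x m‖), sq_nonneg (((m : ℕ) : ℝ) ^ (σ - 1)),
      sq_nonneg ‖x m‖]
  have hsub : ∀ d : ℕ, Summable fun m : ℕ+ => if d ∣ (m : ℕ) then y m else 0 := fun d => by
    refine Summable.of_norm_bounded hy fun m => ?_
    split_ifs <;> simp
  have hgcd : ∀ n : ℕ+, ∑' m : ℕ+, (Nat.gcd n m : ℂ) * y m = 0 := by
    intro n
    have h1 := (lp.hasSum_single (by simp) x).mapL E
    have h2 := h1.mapL (innerSL ℂ (lp.single 2 n (1 : ℂ)))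
    have h3 : ∀ m : ℕ+, innerSL ℂ (lp.single 2 n (1 : ℂ)) (E (lp.single 2 m (x m))) =
        ((((n : ℕ) : ℝ) ^ (σ - 1) : ℝ) : ℂ) * ((Nat.gcd n m : ℂ) * y m) := by
      intro m
      have e1 : lp.single (E := fun _ : ℕ+ => ℂ) 2 m (x m) = x m • lp.single 2 m (1 : ℂ) := by
        rw [← lp.single_smul]; simp
      rw [e1, map_smul, map_smul, innerSL_apply_apply, lp.inner_single_left, hE n m,
        arithEntry_one_eq_gcd]
      simp [y]; ring
    simp only [h3, hx, map_zero] at h2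
    have h4 := h2.tsum_eq
    rw [tsum_mul_left] at h4
    exact (mul_eq_zero.1 h4).resolve_left (by exact_mod_cast (hpos n).ne')
  have hmult : ∀ n : ℕ, 0 < n → ∑' m : ℕ+, (if n ∣ (m : ℕ) then y m else 0) = 0 := by
    intro n
    induction n using Nat.strong_induction_on with
    | _ n ih =>
      intro hn
      have h1 : ∀ m : ℕ+, (Nat.gcd n m : ℂ) * y m =
          ∑ d ∈ n.divisors, (Nat.totient d : ℂ) * (if d ∣ (m : ℕ) then y m else 0) := by
        intro m
        have h2 : (Nat.gcd n m).divisors = n.divisors.filter (fun d => d ∣ (m : ℕ)) := by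
          ext d
          simp only [Nat.mem_divisors, Nat.dvd_gcd_iff, Finset.mem_filter]
          have := (Nat.gcd_pos_of_pos_left (m : ℕ) hn).ne'
          have := hn.ne'
          tauto
        rw [← Nat.sum_totient (Nat.gcd n m), h2, Finset.sum_filter, Nat.cast_sum, Finset.sum_mul]
        refine Finset.sum_congr rfl fun d _ => ?_
        split_ifs <;> simp
      have h3 := hgcd ⟨n, hn⟩
      simp only [PNat.mk_coe, h1] at h3
      rw [Summable.tsum_finsetSum fun d _ => (hsub d).mul_left _] at h3
      simp only [tsum_mul_left] at h3
      rw [Finset.sum_eq_single n] at h3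
      · exact (mul_eq_zero.1 h3).resolve_left
          (by exact_mod_cast (Nat.totient_pos.2 hn).ne')
      · intro d hd hdn
        have hd' := Nat.mem_divisors.1 hd
        rw [ih d (lt_of_le_of_ne (Nat.le_of_dvd hn hd'.1) hdn) (Nat.pos_of_mem_divisors hd),
          mul_zero]
      · intro h
        exact absurd (Nat.mem_divisors_self n hn.ne') h
  have hy0 := eq_zero_of_forall_tsum_multiples_eq_zero hy fun d => hmult d d.pos
  ext m
  exact (mul_eq_zero.1 (hy0 m)).resolve_left (by exact_mod_cast (hpos m).ne')

/-! ### Convergence of the singular values -/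

theorem ContinuousLinearMap.IsPositive.of_tendsto {H : Type*} [NormedAddCommGroup H]
    [InnerProductSpace ℂ H] [CompleteSpace H] {A : ℕ → H →L[ℂ] H} {E : H →L[ℂ] H}
    (hA : ∀ N, (A N).IsPositive) (hE : Tendsto A atTop (𝓝 E)) : E.IsPositive := by
  rw [ContinuousLinearMap.isPositive_iff_complex]
  intro x
  have h1 : Tendsto (fun N => ⟪A N x, x⟫_ℂ) atTop (𝓝 ⟪E x, x⟫_ℂ) :=
    (((ContinuousLinearMap.apply ℂ H x).continuous.tendsto E).comp hE).inner tendsto_const_nhds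
  have h2 := (Complex.continuous_re.tendsto _).comp h1
  refine ⟨?_, ?_⟩
  · refine tendsto_nhds_unique ((Complex.continuous_ofReal.tendsto _).comp h2)
      (h1.congr fun N => ?_)
    exact (((ContinuousLinearMap.isPositive_iff_complex _).1 (hA N)) x).1.symm
  · exact ge_of_tendsto' h2 fun N => (((ContinuousLinearMap.isPositive_iff_complex _).1 (hA N)) x).2

theorem not_finiteDimensional_ellTwo : ¬ FiniteDimensional ℂ EllTwo := by
  intro _
  have h : Orthonormal ℂ fun n : ℕ+ => (lp.single 2 n (1 : ℂ) : EllTwo) := by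
    refine ⟨fun n => ?_, fun n m hnm => ?_⟩
    · rw [lp.norm_single (by simp)]; simp
    · change ⟪lp.single 2 n (1 : ℂ), (lp.single 2 m (1 : ℂ) : EllTwo)⟫_ℂ = 0
      rw [lp.inner_single_left, lp.single_apply_ne _ _ _ hnm]; simp
  have := h.linearIndependent.finite
  exact not_finite ℕ+

/-- The eigenvalues of `E(σ, 1)` and of `ρ * N ^ (-ρ) * Tᴴ * T` with the same index differ by at
most the operator norm of the difference. The Toeplitz matrix acts on `ℂ ^ N`, and the two bounds
compare quadratic forms along the restriction `ℓ²(ℕ) → ℂ ^ N` and its adjoint. -/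
theorem abs_singularValue_sq_sub_le {σ : ℝ} (hσ : σ < 1 / 2) {E : EllTwo →L[ℂ] EllTwo}
    (hE : E.IsPositive) {lam : ℕ → ℝ} (hlam : Antitone lam) {b : HilbertBasis ℕ ℂ EllTwo}
    (hb : ∀ n, E (b n) = (lam n : ℂ) • b n) (hlam0 : ∀ n, 0 ≤ lam n) {N n : ℕ} (hn : n < N) :
    |(1 - 2 * σ) * (N : ℝ) ^ (-(1 - 2 * σ)) *
      matrixSingularValue (truncMultToeplitz (zetaShiftCoeff σ) N) n ^ 2 - lam n| ≤
        ‖truncGram σ N - E‖ := by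
  set δ := ‖truncGram σ N - E‖ with hδ
  set c : ℝ := (1 - 2 * σ) * (N : ℝ) ^ (-(1 - 2 * σ)) with hc
  have hc0 : 0 ≤ c := by
    have : 0 < 1 - 2 * σ := by linarith
    positivity
  have hq : ∀ x : EllTwo, |(⟪x, truncGram σ N x⟫_ℂ).re - (⟪x, E x⟫_ℂ).re| ≤ δ * ‖x‖ ^ 2 := by
    intro x
    rw [← Complex.sub_re, ← inner_sub_right, ← _root_.sub_apply]
    calc _ ≤ ‖⟪x, (truncGram σ N - E) x⟫_ℂ‖ := Complex.abs_re_le_norm _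
      _ ≤ ‖x‖ * (δ * ‖x‖) := (norm_inner_le_norm _ _).trans
          (mul_le_mul_of_nonneg_left ((truncGram σ N - E).le_opNorm x) (norm_nonneg _))
      _ = _ := by ring
  let L : EuclideanSpace ℂ (Fin N) →ₗ[ℂ] EuclideanSpace ℂ (Fin N) :=
    Matrix.toEuclideanLin (truncMultToeplitz (zetaShiftCoeff σ) N)
  have hL : ∀ x, truncToeplitz σ N x = L (truncRestrict N x) := fun x => rfl
  have hdim : finrank ℂ (EuclideanSpace ℂ (Fin N)) = N := by simp
  have hs := L.isSymmetric_adjoint_comp_self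
  let u := hs.eigenvectorBasis hdim
  let B : EuclideanSpace ℂ (Fin N) →ₗ[ℂ] EuclideanSpace ℂ (Fin N) := (c : ℂ) • (L.adjoint ∘ₗ L)
  have hBu : ∀ i, B (u i) = ((c * hs.eigenvalues hdim i : ℝ) : ℂ) • u i := by
    intro i
    simp only [B, u, LinearMap.smul_apply, hs.apply_eigenvectorBasis]
    rw [Complex.ofReal_mul c, mul_smul]
    rfl
  have hBsymm : B.IsSymmetric := hs.smul (by simp)
  have hBq : ∀ y, (⟪y, B y⟫_ℂ).re = c * ‖L y‖ ^ 2 := by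
    intro y
    simp only [B, LinearMap.smul_apply, LinearMap.comp_apply]
    rw [inner_smul_right, LinearMap.adjoint_inner_right, inner_self_eq_norm_sq_to_K,
      Complex.re_ofReal_mul]
    norm_cast
  have hanti := hs.eigenvalues_antitone hdim
  have hsv : matrixSingularValue (truncMultToeplitz (zetaShiftCoeff σ) N) n ^ 2 =
      hs.eigenvalues hdim ⟨n, hn⟩ := L.sq_singularValues_of_lt hdim hn
  rw [hsv]
  have hβ0 : 0 ≤ hs.eigenvalues hdim ⟨n, hn⟩ := hsv ▸ sq_nonneg _
  have hle1 : c * hs.eigenvalues hdim ⟨n, hn⟩ ≤ lam n + δ := by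
    refine eigenvalue_le_eigenvalue_add (n := n) (A := B) (B := (E : EllTwo →ₗ[ℂ] EllTwo))
      (v := fun j => u (Fin.castLE hn j))
      (u.orthonormal.comp _ (Fin.castLE_injective hn)) (fun j => hBu _)
      (fun j => mul_le_mul_of_nonneg_left (hanti ?_) hc0) hE.isSelfAdjoint.isSymmetric b hb
      (hlam0 n) (fun i => (i : ℕ)) (fun i => ?_)
      (J := ((truncRestrict N).adjoint : EuclideanSpace ℂ (Fin N) →ₗ[ℂ] EllTwo))
      (norm_adjoint_truncRestrict_le N) (fun y => ?_)
    · exact Fin.le_def.2 (Nat.lt_succ_iff.1 j.2)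
    · rcases le_or_gt n i with h | h
      · exact Or.inl (hlam h)
      · exact Or.inr ⟨⟨i, h⟩, rfl⟩
    · set z := (truncRestrict N).adjoint y with hz
      have h1 := re_inner_truncGram σ N z
      rw [hL, hz, truncRestrict_adjoint_truncRestrict, ← hz, ← hc, ← hBq] at h1
      have h2 := (abs_le.1 (hq z)).2
      have h3 : δ * ‖z‖ ^ 2 ≤ δ * ‖y‖ ^ 2 := by
        gcongr
        exact norm_adjoint_truncRestrict_le N y
      change (⟪y, B y⟫_ℂ).re ≤ (⟪z, E z⟫_ℂ).re + δ * ‖y‖ ^ 2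
      linarith
  have hle2 : lam n ≤ c * hs.eigenvalues hdim ⟨n, hn⟩ + δ := by
    refine eigenvalue_le_eigenvalue_add (n := n) (A := (E : EllTwo →ₗ[ℂ] EllTwo)) (B := B)
      (v := fun j => b (j : ℕ)) (b.orthonormal.comp _ Fin.val_injective)
      (fun j => hb _) (fun j => hlam (Nat.lt_succ_iff.1 j.2)) hBsymm u.toHilbertBasis
      (fun i => by rw [OrthonormalBasis.coe_toHilbertBasis]; exact hBu i) (mul_nonneg hc0 hβ0)
      (fun i => Fin.castLE hn.le i) (fun i => ?_)
      (J := (truncRestrict N : EllTwo →ₗ[ℂ] EuclideanSpace ℂ (Fin N)))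
      (norm_truncRestrict_le N) (fun x => ?_)
    · rcases le_or_gt n (i : ℕ) with h | h
      · exact Or.inl (mul_le_mul_of_nonneg_left (hanti (Fin.le_def.2 h)) hc0)
      · exact Or.inr ⟨⟨i, h⟩, rfl⟩
    · have h1 := re_inner_truncGram σ N x
      rw [hL, ← hc, ← hBq] at h1
      have h2 := (abs_le.1 (hq x)).1
      change (⟪x, E x⟫_ℂ).re ≤ (⟪truncRestrict N x, B (truncRestrict N x)⟫_ℂ).re + δ * ‖x‖ ^ 2
      linarith
  rw [abs_le]
  constructor <;> linarith

/-- The indices `n` are shifted by one: `lam n` and `matrixSingularValue _ n` are the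
`(n + 1)`-st largest eigenvalue and singular value. -/
theorem corollary3 (σ : ℝ) (hσ : σ < 1 / 2) (ρ : ℝ) (hρ : ρ = 1 - 2 * σ) :
    ∃ E : EllTwo →L[ℂ] EllTwo,
      HasInfiniteMatrix E (arithEntry σ 1) ∧ IsCompactOperator E ∧ E.IsPositive ∧
      ∃ lam : ℕ → ℝ, IsEigenvalueList E lam ∧
        ∃ r : ℕ → ℕ → ℝ,
          (∀ N n : ℕ, n < N →
            matrixSingularValue (truncMultToeplitz (zetaShiftCoeff σ) N) n ^ 2 =
              1 / ρ * (N : ℝ) ^ ρ * (lam n + r N n)) ∧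
          (∀ ε : ℝ, 0 < ε → ∃ N₀ : ℕ, ∀ N : ℕ, N₀ ≤ N → ∀ n : ℕ, n < N → |r N n| < ε) := by
  subst hρ
  have hρ : 0 < 1 - 2 * σ := by linarith
  obtain ⟨E, hmat, hlim⟩ := exists_tendsto_truncGram hσ
  have hcomp : IsCompactOperator E :=
    isCompactOperator_of_tendsto hlim (Eventually.of_forall (isCompactOperator_truncGram σ))
  have hpos : E.IsPositive := .of_tendsto (isPositive_truncGram hσ) hlim
  obtain ⟨lam, b, hanti, hb, hmult⟩ := exists_antitone_eigenbasis not_finiteDimensional_ellTwo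
    hcomp hpos (fun x => hmat.eq_zero_of_apply_eq_zero hσ)
  have hlam0 : ∀ n, 0 ≤ lam n := by
    intro n
    have h := hpos.re_inner_nonneg_right (b n)
    rw [hb, inner_smul_right, inner_self_eq_norm_sq_to_K, b.orthonormal.1] at h
    simpa using h
  refine ⟨E, hmat, hcomp, hpos, lam, ⟨hanti, hmult⟩, fun N n => (1 - 2 * σ) *
    (N : ℝ) ^ (-(1 - 2 * σ)) * matrixSingularValue (truncMultToeplitz (zetaShiftCoeff σ) N) n ^ 2 -
      lam n, fun N n hn => ?_, fun ε hε => ?_⟩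
  · have hN : (0 : ℝ) < N := by exact_mod_cast (Nat.zero_le n).trans_lt hn
    have := (Real.rpow_pos_of_pos hN (1 - 2 * σ)).ne'
    simp only [Real.rpow_neg hN.le]
    field_simp
    ring
  · obtain ⟨N₀, hN₀⟩ := Metric.tendsto_atTop.1 hlim ε hε
    refine ⟨N₀, fun N hN n hn => ?_⟩
    refine (abs_singularValue_sq_sub_le hσ hpos hanti hb hlam0 hn).trans_lt ?_
    rw [← dist_eq_norm]
    exact hN₀ N hN
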